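/- Let $\mathcal G=(V,E)$ be a finite connected simple graph with non-empty vertex set, and for $x\in V$ let $[x]$ consist of $x$ and its neighbours. Let $(\xi_x)_{x\in V}$ be independent Poisson processes of unit intensity. In the (next nearest neighbour) ballistic deposition process on $\mathcal G$ all heights are $0$ at time $0$, and at each jump time of $\xi_x$ the height of $x$ is changed from $h_x$ to $1+\max_{y\in[x]}h_y$, where $h$ is the height configuration just before the jump; no other height changes. Let $\tilde H_{x,t}$ be the height of $x$ at time $t$. The growth parameter $\gamma(\mathcal G)$ is the almost sure constant limit $$\gamma(\mathcal G)=\lim_{t\to\infty}\frac1t\max_{x\in V}\tilde H_{x,t}=\lim_{t\to\infty}\frac1t\min_{x\in V}\tilde H_{x,t}.$$ Write $\Delta\mathcal G$ for the maximal degree of $\mathcal G$, and let the girth of $\mathcal G$ be the number of edges of its shortest cycle ($\infty$ if there is no cycle). Proposition. Let $(\mathcal G_n)_{n\ge0}$ be a sequence of finite connected regular graphs with non-empty vertex sets such that $\Delta\mathcal G_n\to\infty$ as $n\to\infty$ and such that every $\mathcal G_n$ has girth at least $5$. Then the almost sure limits defining $\gamma(\mathcal G_n)$ exist for every $n$, and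 $$\liminf_{n\to\infty}\frac{\gamma(\mathcal G_n)}{\Delta\mathcal G_n}\ \ge\ \frac{2e-1}{(e-1)^2}\approx1.503,$$ where the approximation is meant with an error of less than $0.0005$. -/

import Mathlib

open MeasureTheory ProbabilityTheory Filter Topology

namespace BallisticDeposition

instance : IsProbabilityMeasure (expMeasure 1) := isProbabilityMeasure_expMeasure one_pos

/-- Sample points: `ω x i` is the waiting time between the `i`-th and the `(i+1)`-st jump of the
Poisson process attached to the vertex `x`. -/
abbrev Sample (V : Type*) : Type _ := V → ℕ → ℝ

/-- The law of a family, indexed by `V`, of independent Poisson processes of unit intensity: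
all waiting times are independent and exponentially distributed with mean one. -/
noncomputable def poissonLaw (V : Type*) [Fintype V] : Measure (Sample V) :=
  Measure.pi fun _ : V => Measure.infinitePi fun _ : ℕ => expMeasure 1

instance (V : Type*) [Fintype V] : IsProbabilityMeasure (poissonLaw V) := by
  unfold poissonLaw; infer_instance

/-- The time of the `(i+1)`-st jump of the Poisson process attached to `x`. -/
noncomputable def arrival {V : Type*} (ω : Sample V) (x : V) (i : ℕ) : ℝ :=
  ∑ j ∈ Finset.range (i + 1), ω x j

/-- The jump times of all the Poisson processes, listed in increasing order after `jumpTime ω 0 = 0`: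
`jumpTime ω (k + 1)` is the first time after `jumpTime ω k` at which some process jumps. -/
noncomputable def jumpTime {V : Type*} (ω : Sample V) : ℕ → ℝ
  | 0 => 0
  | k + 1 => sInf {t : ℝ | jumpTime ω k < t ∧ ∃ x i, arrival ω x i = t}

open Classical in
/-- The closed neighbourhood `[x]`. -/
noncomputable def closedNbhd {V : Type*} [Fintype V] (G : SimpleGraph V) (x : V) : Finset V :=
  Finset.univ.filter fun y => y = x ∨ G.Adj x y

open Classical in
/-- The height configuration right after the `k`-th jump, started from the flat configuration.
If the process attached to `x` jumps, then the height of `x` becomes `1 + max_{y ∈ [x]} h y`,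
where `h` is the previous configuration; the other heights are kept. -/
noncomputable def heightAfterJump {V : Type*} [Fintype V] (G : SimpleGraph V) (ω : Sample V) :
    ℕ → V → ℕ
  | 0 => fun _ => 0
  | k + 1 => fun x =>
      if ∃ i, arrival ω x i = jumpTime ω (k + 1)
      then 1 + (closedNbhd G x).sup (heightAfterJump G ω k)
      else heightAfterJump G ω k x

/-- The number of jumps in the time interval `(0, t]`. -/
noncomputable def jumpCount {V : Type*} (ω : Sample V) (t : ℝ) : ℕ :=
  sSup {k : ℕ | jumpTime ω k ≤ t}

/-- The height of the vertex `x` at time `t` in the continuous-time ballistic deposition process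
on `G`. -/
noncomputable def height {V : Type*} [Fintype V] (G : SimpleGraph V) (ω : Sample V) (t : ℝ)
    (x : V) : ℕ :=
  heightAfterJump G ω (jumpCount ω t) x

/-- `g` is the almost sure limit of both `(max_x height) / t` and `(min_x height) / t`. -/
def IsGrowthParameter {V : Type*} [Fintype V] (G : SimpleGraph V) (g : ℝ) : Prop :=
  ∀ᵐ ω ∂(poissonLaw V),
    Tendsto (fun t : ℝ => ((⨆ x, height G ω t x : ℕ) : ℝ) / t) atTop (𝓝 g) ∧
    Tendsto (fun t : ℝ => ((⨅ x, height G ω t x : ℕ) : ℝ) / t) atTop (𝓝 g)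

theorem IsGrowthParameter.unique {V : Type*} [Fintype V] {G : SimpleGraph V} {g g' : ℝ}
    (h : IsGrowthParameter G g) (h' : IsGrowthParameter G g') : g = g' := by
  obtain ⟨ω, h1, h2⟩ := (h.and h').exists
  exact tendsto_nhds_unique h1.1 h2.1

open Classical in
/-- The growth parameter `γ(G)`: the unique `g` with `IsGrowthParameter G g`
(and `0` in case there is none). -/
noncomputable def growthParameter {V : Type*} [Fintype V] (G : SimpleGraph V) : ℝ :=
  if h : ∃ g, IsGrowthParameter G g then h.choose else 0

end BallisticDeposition

/-! Existence of the limits. At its jump times the process is a Markov chain: each jump sits at a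
uniformly chosen vertex, independently of the past (`isUniformMark`). The dynamics are monotone and
commute with adding constants, so from the flat start the maximum is subadditive and the minimum
superadditive. Cutting time into blocks of length m and applying the strong law to the i.i.d. block
values bounds the maximum above by E[max]/m and the minimum below by E[min]/m per jump. By
connectedness some fixed word of jumps lifts every height to the old maximum; it keeps occurring
with positive probability, so the mean gap between maximum and minimum stays bounded
(`exists_gap_bound`) and the two bounds meet as m grows (`IsUniformMark.exists_growth`). With n
vertices the waiting times between jumps are i.i.d. with mean 1/n, so passing to continuous time
multiplies the speed by n (`exists_isGrowthParameter`).

Lower bound. If a function F of the configuration is at most the maximum plus a constant and its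
mean increases by at least δ in every jump, then γ ≥ nδ (`card_mul_le_growthParameter`). Let b
vertices have maximal height and a vertices be one below. A jump next to a peak makes a new record
and turns (a, b) into roughly (b, 1); a jump next to a shoulder but away from the peaks turns it
into roughly (a, b + 1). Girth at least 5 makes closed neighbourhoods nearly disjoint, so for large
degree d, as long as a and b are bounded, these events happen at rates close to bd and ad. Counting
a only up to 2 and b only up to 3 leaves seven classes, and `weight` gives each class a value such
that the drift of 118 · max + weight is at least 180d up to a bounded error (`le_drift_potential`).
Hence liminf γ/d ≥ 180/118 = 90/59, which already exceeds (2e − 1)/(e − 1)²; that constant enters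
only in the numerical comparison `growthConstant_bounds`. -/

namespace BallisticDeposition

/-! ### Deterministic dynamics: monotonicity, translation, and the mean gap -/

section Deterministic

set_option linter.unusedSectionVars false

variable {V : Type*} [Fintype V] (G : SimpleGraph V)

open Classical in
/-- The configuration after a jump at `z`. -/
noncomputable def jumpAt (h : V → ℕ) (z : V) : V → ℕ := fun x =>
  if x = z then 1 + (closedNbhd G x).sup h else h x

/-- The configuration after `k` jumps at the vertices `u 0, u 1, …`. -/
noncomputable def run (h : V → ℕ) (u : ℕ → V) : ℕ → V → ℕ
  | 0 => h
  | k + 1 => jumpAt G (run h u k) (u k)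

/-- The maximal height. -/
noncomputable def top (h : V → ℕ) : ℕ := Finset.univ.sup h

theorem le_top (h : V → ℕ) (x : V) : h x ≤ top h := Finset.le_sup (Finset.mem_univ x)

theorem top_le {h : V → ℕ} {c : ℕ} (H : ∀ x, h x ≤ c) : top h ≤ c :=
  Finset.sup_le fun x _ => H x

theorem exists_eq_top [Nonempty V] (h : V → ℕ) : ∃ x, h x = top h := by
  obtain ⟨x, -, hx⟩ := Finset.exists_mem_eq_sup Finset.univ Finset.univ_nonempty h
  exact ⟨x, hx.symm⟩

/-- The minimal height. -/
noncomputable def bot (h : V → ℕ) : ℕ := ⨅ x, h x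

theorem bot_le (h : V → ℕ) (x : V) : bot h ≤ h x := ciInf_le (OrderBot.bddBelow _) x

theorem le_bot [Nonempty V] {h : V → ℕ} {c : ℕ} (H : ∀ x, c ≤ h x) : c ≤ bot h := le_ciInf H

theorem iSup_eq_top [Nonempty V] (h : V → ℕ) : ⨆ x, h x = top h :=
  le_antisymm (ciSup_le (le_top h))
    (top_le fun x => le_ciSup (Set.finite_range h).bddAbove x)

variable {G}

theorem mem_closedNbhd {x y : V} : y ∈ closedNbhd G x ↔ y = x ∨ G.Adj x y := by
  simp [closedNbhd]

theorem self_mem_closedNbhd (x : V) : x ∈ closedNbhd G x := mem_closedNbhd.2 (Or.inl rfl)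

theorem jumpAt_self (h : V → ℕ) (z : V) : jumpAt G h z z = 1 + (closedNbhd G z).sup h := by
  simp [jumpAt]

theorem jumpAt_of_ne (h : V → ℕ) {x z : V} (hx : x ≠ z) : jumpAt G h z x = h x := by
  simp [jumpAt, hx]

theorem jumpAt_mono {h h' : V → ℕ} (H : h ≤ h') (z : V) : jumpAt G h z ≤ jumpAt G h' z := by
  intro x
  by_cases hx : x = z
  · subst hx
    rw [jumpAt_self, jumpAt_self]
    exact Nat.add_le_add_left (Finset.sup_mono_fun fun y _ => H y) 1
  · rw [jumpAt_of_ne _ hx, jumpAt_of_ne _ hx]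
    exact H x

theorem le_jumpAt (h : V → ℕ) (z : V) : h ≤ jumpAt G h z := by
  intro x
  by_cases hx : x = z
  · subst hx
    rw [jumpAt_self]
    exact (Finset.le_sup (f := h) (self_mem_closedNbhd (G := G) x)).trans (Nat.le_add_left _ _)
  · rw [jumpAt_of_ne _ hx]

theorem lt_jumpAt (h : V → ℕ) {y z : V} (hy : y ∈ closedNbhd G z) : h y < jumpAt G h z z := by
  rw [jumpAt_self]
  have := Finset.le_sup (f := h) hy
  omega

theorem jumpAt_le_top (h : V → ℕ) (z x : V) : jumpAt G h z x ≤ top h + 1 := by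
  by_cases hx : x = z
  · subst hx
    rw [jumpAt_self]
    have : (closedNbhd G x).sup h ≤ top h := Finset.sup_mono (Finset.subset_univ _)
    omega
  · rw [jumpAt_of_ne _ hx]
    exact (le_top h x).trans (Nat.le_succ _)

/-- Together with monotonicity this gives sub- and superadditivity: a configuration is compared with
the flat one at its maximal or minimal height. -/
theorem jumpAt_add_const (h : V → ℕ) (c : ℕ) (z : V) :
    jumpAt G (fun x => c + h x) z = fun x => c + jumpAt G h z x := by
  funext x
  by_cases hx : x = z
  · subst hx
    rw [jumpAt_self, jumpAt_self]
    obtain ⟨y, hy, hy'⟩ := Finset.exists_mem_eq_sup (closedNbhd G x)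
      ⟨x, self_mem_closedNbhd x⟩ h
    have h1 : (closedNbhd G x).sup (fun x => c + h x) ≤ c + h y := by
      refine Finset.sup_le fun w hw => ?_
      have := Finset.le_sup (f := h) hw
      omega
    have h2 := Finset.le_sup (f := fun x => c + h x) hy
    omega
  · rw [jumpAt_of_ne _ hx, jumpAt_of_ne _ hx]

theorem run_first (h : V → ℕ) (u : ℕ → V) (k : ℕ) :
    run G h u (k + 1) = run G (jumpAt G h (u 0)) (fun i => u (i + 1)) k := by
  induction k with
  | zero => rfl
  | succ k ih => rw [run, ih]; rfl

theorem run_add (h : V → ℕ) (u : ℕ → V) (m k : ℕ) :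
    run G h u (m + k) = run G (run G h u m) (fun i => u (m + i)) k := by
  induction k with
  | zero => rfl
  | succ k ih => rw [← add_assoc, run, ih]; rfl

theorem run_mono {h h' : V → ℕ} (H : h ≤ h') (u : ℕ → V) (k : ℕ) :
    run G h u k ≤ run G h' u k := by
  induction k with
  | zero => exact H
  | succ k ih => exact jumpAt_mono ih _

theorem le_run (h : V → ℕ) (u : ℕ → V) (k : ℕ) : h ≤ run G h u k := by
  induction k with
  | zero => exact le_rfl
  | succ k ih => exact ih.trans (le_jumpAt _ _)

theorem run_le_top (h : V → ℕ) (u : ℕ → V) (k : ℕ) (x : V) : run G h u k x ≤ top h + k := by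
  induction k generalizing x with
  | zero => exact le_top h x
  | succ k ih =>
    have h1 := jumpAt_le_top (G := G) (run G h u k) (u k) x
    have h2 : top (run G h u k) ≤ top h + k := top_le ih
    simp only [run]
    omega

theorem run_add_const (h : V → ℕ) (c : ℕ) (u : ℕ → V) (k : ℕ) :
    run G (fun x => c + h x) u k = fun x => c + run G h u k x := by
  induction k with
  | zero => rfl
  | succ k ih => rw [run, ih, jumpAt_add_const]; rfl

/-- The maximal height of the process started from the flat configuration is subadditive. -/
theorem top_run_add_le (u : ℕ → V) (m k : ℕ) :
    top (run G 0 u (m + k)) ≤ top (run G 0 u m) + top (run G 0 (fun i => u (m + i)) k) := by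
  refine top_le fun x => ?_
  rw [run_add]
  have h1 : run G 0 u m ≤ fun x => top (run G 0 u m) + (0 : V → ℕ) x := fun x => le_top _ x
  have h2 := run_mono (G := G) h1 (fun i => u (m + i)) k x
  rw [run_add_const] at h2
  exact h2.trans (Nat.add_le_add_left (le_top _ x) _)

/-- The minimal height of the process started from the flat configuration is superadditive. -/
theorem bot_run_add_ge [Nonempty V] (u : ℕ → V) (m k : ℕ) :
    bot (run G 0 u m) + bot (run G 0 (fun i => u (m + i)) k) ≤ bot (run G 0 u (m + k)) := by
  refine le_bot fun x => ?_
  rw [run_add]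
  have h1 : (fun x => bot (run G 0 u m) + (0 : V → ℕ) x) ≤ run G 0 u m := fun x => bot_le _ x
  have h2 := run_mono (G := G) h1 (fun i => u (m + i)) k x
  rw [run_add_const] at h2
  exact (Nat.add_le_add_left (bot_le _ x) _).trans h2

theorem le_foldl_jumpAt (h : V → ℕ) (l : List V) : h ≤ l.foldl (jumpAt G) h := by
  induction l generalizing h with
  | nil => exact le_rfl
  | cons a l ih => exact (le_jumpAt h a).trans (ih _)

/-- Jumping in turn at the vertices of a walk from y to x carries the height of y along the walk. -/
theorem exists_list_le_of_reachable {x y : V} (H : G.Reachable y x) :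
    ∃ l : List V, ∀ h : V → ℕ, h y ≤ l.foldl (jumpAt G) h x := by
  obtain ⟨w⟩ := H
  induction w with
  | nil => exact ⟨[], fun h => le_rfl⟩
  | @cons a b c hab w ih =>
    obtain ⟨l, hl⟩ := ih
    refine ⟨b :: l, fun h => ?_⟩
    exact (lt_jumpAt h (mem_closedNbhd.2 (Or.inr hab.symm))).le.trans (hl _)

/-- In a connected graph there is a word of jumps after which all heights
are at least the previous maximum. -/
theorem exists_list_top_le [Nonempty V] (hG : G.Connected) :
    ∃ l : List V, l ≠ [] ∧ ∀ (h : V → ℕ) (x : V), top h ≤ l.foldl (jumpAt G) h x := by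
  classical
  have key : ∀ S : Finset (V × V), ∃ l : List V, ∀ p ∈ S, ∀ h : V → ℕ,
      h p.1 ≤ l.foldl (jumpAt G) h p.2 := by
    intro S
    induction S using Finset.induction_on with
    | empty => exact ⟨[], by simp⟩
    | insert p S _ ih =>
      obtain ⟨l, hl⟩ := ih
      obtain ⟨l', hl'⟩ := exists_list_le_of_reachable (hG.preconnected p.1 p.2)
      refine ⟨l ++ l', fun q hq h => ?_⟩
      rw [List.foldl_append]
      rcases Finset.mem_insert.1 hq with rfl | hq
      · exact (le_foldl_jumpAt h l q.1).trans (hl' _)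
      · exact (hl q hq h).trans (le_foldl_jumpAt _ l' q.2)
  obtain ⟨l, hl⟩ := key Finset.univ
  obtain ⟨v⟩ := ‹Nonempty V›
  refine ⟨l ++ [v], by simp, fun h x => top_le fun y => ?_⟩
  rw [List.foldl_append]
  exact (hl (y, x) (Finset.mem_univ _) h).trans (le_foldl_jumpAt _ _ _)

/-! ### The averaging operator -/

/-- The expectation of `F` after a jump at a uniformly chosen vertex. -/
noncomputable def avg (G : SimpleGraph V) (F : (V → ℕ) → ℝ) (h : V → ℕ) : ℝ :=
  (∑ z, F (jumpAt G h z)) / Fintype.card V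

theorem avg_mono {F F' : (V → ℕ) → ℝ} (H : F ≤ F') : avg G F ≤ avg G F' := fun _ =>
  div_le_div_of_nonneg_right (Finset.sum_le_sum fun _ _ => H _) (Nat.cast_nonneg _)

theorem avg_iterate_mono {F F' : (V → ℕ) → ℝ} (H : F ≤ F') (k : ℕ) :
    (avg G)^[k] F ≤ (avg G)^[k] F' :=
  (show Monotone (avg G) from fun _ _ => avg_mono).iterate k H

theorem avg_affine [Nonempty V] (F : (V → ℕ) → ℝ) (a c : ℝ) :
    avg G (fun h => a * F h + c) = fun h => a * avg G F h + c := by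
  funext h
  have : (Fintype.card V : ℝ) ≠ 0 := Nat.cast_ne_zero.2 Fintype.card_ne_zero
  simp only [avg, Finset.sum_add_distrib, ← Finset.mul_sum, Finset.sum_const, Finset.card_univ,
    nsmul_eq_mul]
  field_simp

theorem avg_iterate_affine [Nonempty V] (F : (V → ℕ) → ℝ) (a c : ℝ) (k : ℕ) :
    (avg G)^[k] (fun h => a * F h + c) = fun h => a * (avg G)^[k] F h + c := by
  induction k generalizing F with
  | zero => rfl
  | succ k ih => rw [Function.iterate_succ_apply, avg_affine, ih, Function.iterate_succ_apply]

theorem avg_iterate_add [Nonempty V] (F F' : (V → ℕ) → ℝ) (k : ℕ) :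
    (avg G)^[k] (fun h => F h + F' h) = fun h => (avg G)^[k] F h + (avg G)^[k] F' h := by
  induction k generalizing F F' with
  | zero => rfl
  | succ k ih =>
    have : avg G (fun h => F h + F' h) = fun h => avg G F h + avg G F' h := by
      funext h
      simp only [avg, Finset.sum_add_distrib, add_div]
    rw [Function.iterate_succ_apply, this, ih]
    rfl

/-- A potential whose mean increases by at least `δ` in each jump. -/
theorem add_le_avg_iterate [Nonempty V] {F : (V → ℕ) → ℝ} {δ : ℝ} (H : ∀ h, F h + δ ≤ avg G F h)
    (k : ℕ) (h : V → ℕ) : F h + k * δ ≤ (avg G)^[k] F h := by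
  induction k with
  | zero => simp
  | succ k ih =>
    have h1 : (fun h => 1 * F h + δ) ≤ avg G F := fun h => by simpa using H h
    have h2 := avg_iterate_mono (G := G) h1 k h
    rw [avg_iterate_affine, ← Function.iterate_succ_apply] at h2
    push_cast
    linarith

/-- Uniform jumps spell the word `l` with probability n^(-|l|); in that case F is at most a, and in
any case at most b. -/
theorem avg_iterate_le_of_list [Nonempty V] (l : List V) (h : V → ℕ) {F : (V → ℕ) → ℝ} {a b : ℝ}
    (hF : ∀ w : ℕ → V, F (run G h w l.length) ≤ b) (hl : F (l.foldl (jumpAt G) h) ≤ a) :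
    (avg G)^[l.length] F h ≤
      b - ((Fintype.card V : ℝ)⁻¹) ^ l.length * (b - a) := by
  have hn : (0 : ℝ) < Fintype.card V := Nat.cast_pos.2 Fintype.card_pos
  induction l generalizing h with
  | nil => simpa using hl
  | cons v l ih =>
    classical
    have hgen : ∀ (k : ℕ) (g : V → ℕ), (∀ w : ℕ → V, F (run G g w k) ≤ b) →
        (avg G)^[k] F g ≤ b := by
      intro k
      induction k with
      | zero => exact fun g hg => hg fun _ => v
      | succ k ihk =>
        intro g hg
        rw [Function.iterate_succ_apply']
        rw [avg, div_le_iff₀ hn]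
        have : ∑ z, (avg G)^[k] F (jumpAt G g z) ≤ ∑ _z : V, b := by
          refine Finset.sum_le_sum fun z _ => ihk _ fun w => ?_
          have := hg (fun i => Nat.casesOn i z w)
          rwa [run_first] at this
        simpa [mul_comm] using this
    have hfirst : ∀ z, ∀ w : ℕ → V, F (run G (jumpAt G h z) w l.length) ≤ b := by
      intro z w
      have := hF (fun i => Nat.casesOn i z w)
      rwa [List.length_cons, run_first] at this
    rw [List.length_cons, Function.iterate_succ_apply', avg, div_le_iff₀ hn]
    have h1 := ih (jumpAt G h v) (hfirst v) hl
    have h2 : ∑ z, (avg G)^[l.length] F (jumpAt G h z) ≤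
        ∑ z : V, (b - if z = v then ((Fintype.card V : ℝ)⁻¹) ^ l.length * (b - a) else 0) := by
      refine Finset.sum_le_sum fun z _ => ?_
      split_ifs with hz
      · rw [hz]; exact h1
      · simpa using hgen _ _ (hfirst z)
    refine h2.trans (le_of_eq ?_)
    simp only [Finset.sum_sub_distrib, Finset.sum_ite_eq', Finset.mem_univ, if_true,
      Finset.sum_const, Finset.card_univ, nsmul_eq_mul, pow_succ]
    field_simp

/-- The mean gap between the maximal and the minimal height stays bounded along a
suitable arithmetic progression. -/
theorem exists_gap_bound [Nonempty V] (hG : G.Connected) :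
    ∃ L : ℕ, 0 < L ∧ ∃ C : ℝ, ∀ j : ℕ,
      (avg G)^[j * L] (fun h => (top h : ℝ) - bot h) 0 ≤ C := by
  obtain ⟨l, hl0, hl⟩ := exists_list_top_le hG
  have hn : (1 : ℝ) ≤ Fintype.card V := by exact_mod_cast Fintype.card_pos (α := V)
  set L := l.length with hL
  set p : ℝ := ((Fintype.card V : ℝ)⁻¹) ^ L with hp
  have hp0 : 0 < p := by positivity
  have hp1 : p ≤ 1 := pow_le_one₀ (by positivity) (inv_le_one_of_one_le₀ hn)
  set R : (V → ℕ) → ℝ := fun h => (top h : ℝ) - bot h with hR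
  -- L jumps raise the gap by at most L; with probability p they spell the lifting word, after which
  -- the gap is at most L whatever it was before.
  have step : (avg G)^[L] R ≤ fun h => (1 - p) * R h + L := by
    intro h
    have h1 := avg_iterate_le_of_list (G := G) l h (F := R) (a := L) (b := R h + L) ?_ ?_
    · refine h1.trans (le_of_eq ?_)
      simp only [← hL, ← hp]
      ring
    · intro w
      have e1 : top (run G h w L) ≤ top h + L := top_le (run_le_top h w L)
      have e2 : bot h ≤ bot (run G h w L) := le_bot fun x => (bot_le h x).trans (le_run h w L x)
      have e1' : (top (run G h w L) : ℝ) ≤ top h + L := by exact_mod_cast e1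
      have e2' : (bot h : ℝ) ≤ bot (run G h w L) := by exact_mod_cast e2
      simp only [hR, ← hL]
      linarith
    · have e1 : ∀ (l : List V) (h : V → ℕ), top (l.foldl (jumpAt G) h) ≤ top h + l.length := by
        intro l
        induction l with
        | nil => simp
        | cons a l ih =>
          intro h
          have h1 := ih (jumpAt G h a)
          have h2 : top (jumpAt G h a) ≤ top h + 1 := top_le (jumpAt_le_top h a)
          simp only [List.foldl_cons, List.length_cons]
          omega
      have e2 : top h ≤ bot (l.foldl (jumpAt G) h) := le_bot (hl h)
      have e1' : (top (l.foldl (jumpAt G) h) : ℝ) ≤ top h + L := by exact_mod_cast e1 l h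
      have e2' : (top h : ℝ) ≤ bot (l.foldl (jumpAt G) h) := by exact_mod_cast e2
      simp only [hR]
      linarith
  -- L / p is the fixed point of r ↦ (1 - p) r + L.
  refine ⟨L, List.length_pos_iff.2 hl0, L / p, fun j => ?_⟩
  induction j with
  | zero =>
    have : top (0 : V → ℕ) ≤ 0 := top_le fun _ => le_rfl
    have h0 : (top (0 : V → ℕ) : ℝ) = 0 := by exact_mod_cast Nat.le_zero.1 this
    simp only [Nat.zero_mul, Function.iterate_zero, id, hR, h0]
    have : (0 : ℝ) ≤ (bot (0 : V → ℕ) : ℝ) := Nat.cast_nonneg _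
    have : 0 ≤ (L : ℝ) / p := by positivity
    linarith
  | succ j ih =>
    have h1 := avg_iterate_mono (G := G) step (j * L) 0
    rw [avg_iterate_affine, ← Function.iterate_add_apply] at h1
    have h2 : (j + 1) * L = j * L + L := by ring
    rw [h2]
    refine h1.trans ?_
    have h3 : (1 - p) * (avg G)^[j * L] R 0 ≤ (1 - p) * (L / p) :=
      mul_le_mul_of_nonneg_left ih (by linarith)
    have h4 : (1 - p) * ((L : ℝ) / p) + L = L / p := by field_simp; ring
    linarith

end Deterministic

/-! ### Strong law along a measure preserving map -/

section StrongLaw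

variable {Ω : Type*} [MeasurableSpace Ω] {μ : Measure Ω}

/-- The strong law of large numbers along a measure preserving map whose iterates
renew the observable. -/
theorem strong_law_of_indepFun {S : Ω → Ω} (hS : MeasurePreserving S μ μ) {f : Ω → ℝ}
    (hf : Measurable f) (hint : Integrable f μ) (hind : IndepFun f S μ) :
    ∀ᵐ ω ∂μ, Tendsto (fun n : ℕ => (∑ i ∈ Finset.range n, f (S^[i] ω)) / n) atTop
      (𝓝 (∫ ω, f ω ∂μ)) := by
  have hSi : ∀ i, MeasurePreserving S^[i] μ μ := hS.iterate
  -- Pairwise independence suffices for the strong law; invariance reduces it to the case i = 0.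
  have hlt : ∀ i d : ℕ, IndepFun (fun ω => f (S^[i] ω)) (fun ω => f (S^[i + (d + 1)] ω)) μ := by
    intro i d
    have h1 : IndepFun f (fun ω => f (S^[d] (S ω))) μ :=
      hind.comp measurable_id (hf.comp (hSi d).measurable)
    rw [indepFun_iff_measure_inter_preimage_eq_mul] at h1 ⊢
    intro s t hs ht
    have e1 : MeasurableSet (f ⁻¹' s) := hf hs
    have e2 : MeasurableSet ((fun ω => f (S^[d] (S ω))) ⁻¹' t) :=
      (hf.comp ((hSi d).measurable.comp hS.measurable)) ht
    have e3 : (fun ω => f (S^[i + (d + 1)] ω)) = (fun ω => f (S^[d] (S ω))) ∘ S^[i] := by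
      funext ω
      rw [Nat.add_comm, Function.iterate_add_apply, Function.iterate_succ_apply]
      rfl
    have e4 : (fun ω => f (S^[i] ω)) = f ∘ S^[i] := rfl
    rw [e3, e4, Set.preimage_comp, Set.preimage_comp, ← Set.preimage_inter,
      (hSi i).measure_preimage (e1.inter e2).nullMeasurableSet,
      (hSi i).measure_preimage e1.nullMeasurableSet,
      (hSi i).measure_preimage e2.nullMeasurableSet]
    exact h1 s t hs ht
  refine strong_law_ae_real (fun i ω => f (S^[i] ω)) hint ?_ ?_
  · intro i j hij
    rcases lt_or_gt_of_ne hij with h | h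
    · obtain ⟨d, rfl⟩ := Nat.exists_eq_add_of_lt h
      exact hlt i d
    · obtain ⟨d, rfl⟩ := Nat.exists_eq_add_of_lt h
      exact (hlt j d).symm
  · intro i
    refine ⟨(hf.comp (hSi i).measurable).aemeasurable, hf.aemeasurable, ?_⟩
    have : (fun ω => f (S^[i] ω)) = f ∘ S^[i] := rfl
    rw [this, ← Measure.map_map hf (hSi i).measurable, (hSi i).map_eq]
    rfl

end StrongLaw

/-- Turns a limit per block of m jumps into a limit per jump, along all k and not only multiples of
m. -/
theorem tendsto_div_of_tendsto_div {s : ℕ → ℝ} {A : ℝ}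
    (hs : Tendsto (fun n : ℕ => s n / n) atTop (𝓝 A)) {m : ℕ} (hm : 0 < m) :
    Tendsto (fun k : ℕ => s (k / m) / k) atTop (𝓝 (A / m)) := by
  have h1 : Tendsto (fun k : ℕ => k / m) atTop atTop := Nat.tendsto_div_const_atTop hm.ne'
  have h2 : Tendsto (fun k : ℕ => ((k / m : ℕ) : ℝ) / k) atTop (𝓝 ((m : ℝ)⁻¹)) := by
    have := (tendsto_nat_floor_mul_div_atTop (R := ℝ) (a := (m : ℝ)⁻¹) (by positivity)).comp
      tendsto_natCast_atTop_atTop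
    refine this.congr fun k => ?_
    simp only [Function.comp]
    rw [inv_mul_eq_div, Nat.floor_div_natCast, Nat.floor_natCast]
  have h3 := (hs.comp h1).mul h2
  rw [div_eq_mul_inv]
  refine h3.congr' ?_
  filter_upwards [h1.eventually_gt_atTop 0, eventually_gt_atTop 0] with k hk hk'
  have hk1 : ((k / m : ℕ) : ℝ) ≠ 0 := by exact_mod_cast hk.ne'
  simp only [Function.comp]
  field_simp

/-! ### Independent uniform marks and the Markov property -/

section Marks

set_option linter.unusedSectionVars false

variable {V : Type*} [Fintype V] {G : SimpleGraph V} {Ω : Type*}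

/-- The sequence of marks read off along the iterates of `Θ`. -/
def marks (ζ : Ω → V) (Θ : Ω → Ω) (ω : Ω) (k : ℕ) : V := ζ (Θ^[k] ω)

theorem marks_iterate (ζ : Ω → V) (Θ : Ω → Ω) (ω : Ω) (m : ℕ) :
    marks ζ Θ (Θ^[m] ω) = fun i => marks ζ Θ ω (m + i) := by
  funext i
  rw [marks, marks, Nat.add_comm, Function.iterate_add_apply]

theorem run_marks_succ (ζ : Ω → V) (Θ : Ω → Ω) (ω : Ω) (h : V → ℕ) (k : ℕ) :
    run G h (marks ζ Θ ω) (k + 1) = run G (jumpAt G h (ζ ω)) (marks ζ Θ (Θ ω)) k := by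
  rw [run_first]
  rfl

variable [MeasurableSpace Ω] {μ : Measure Ω} {ζ : Ω → V} {Θ : Ω → Ω}

/-- The mark `ζ` is uniformly distributed, `Θ` preserves `μ`, and both are independent. -/
structure IsUniformMark [MeasurableSpace V] (μ : Measure Ω) (ζ : Ω → V) (Θ : Ω → Ω) : Prop where
  measurable_mark : Measurable ζ
  measurable_shift : Measurable Θ
  measure_inter : ∀ (z : V) (B : Set Ω), MeasurableSet B →
    μ (ζ ⁻¹' {z} ∩ Θ ⁻¹' B) = (Fintype.card V : ENNReal)⁻¹ * μ B

variable [MeasurableSpace V] [MeasurableSingletonClass V]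

theorem measurable_run (hζ : Measurable ζ) (hΘ : Measurable Θ) (h : V → ℕ) (k : ℕ) :
    Measurable fun ω => run G h (marks ζ Θ ω) k := by
  induction k with
  | zero => exact measurable_const
  | succ k ih =>
    have h1 : Measurable fun p : (V → ℕ) × V => jumpAt G p.1 p.2 := measurable_of_countable _
    exact h1.comp (ih.prodMk (hζ.comp (hΘ.iterate k)))

namespace IsUniformMark

theorem measure_eq_sum (hm : IsUniformMark μ ζ Θ) (A : Set Ω) :
    μ A = ∑ z, μ (ζ ⁻¹' {z} ∩ A) := by
  have h1 := sum_measure_preimage_singleton (μ := μ.restrict A) (f := ζ) Finset.univ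
    fun z _ => hm.measurable_mark (measurableSet_singleton z)
  rw [Finset.coe_univ, Set.preimage_univ, Measure.restrict_apply_univ] at h1
  rw [← h1]
  exact Finset.sum_congr rfl fun z _ =>
    Measure.restrict_apply (hm.measurable_mark (measurableSet_singleton z))

theorem measurePreserving [Nonempty V] (hm : IsUniformMark μ ζ Θ) : MeasurePreserving Θ μ μ := by
  refine ⟨hm.measurable_shift, Measure.ext fun B hB => ?_⟩
  rw [Measure.map_apply hm.measurable_shift hB, hm.measure_eq_sum]
  simp only [hm.measure_inter _ _ hB, Finset.sum_const, Finset.card_univ, nsmul_eq_mul]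
  rw [← mul_assoc, ENNReal.mul_inv_cancel (by simp) (by simp), one_mul]

/-- The first m steps use only the first m marks. The induction conditions on the first mark, so the
initial configuration has to vary. -/
theorem measure_run_inter [Nonempty V] [IsProbabilityMeasure μ] (hm : IsUniformMark μ ζ Θ) (m : ℕ)
    (h c : V → ℕ) {B : Set Ω} (hB : MeasurableSet B) :
    μ ((fun ω => run G h (marks ζ Θ ω) m) ⁻¹' {c} ∩ Θ^[m] ⁻¹' B) =
      μ ((fun ω => run G h (marks ζ Θ ω) m) ⁻¹' {c}) * μ B := by
  induction m generalizing h with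
  | zero =>
    by_cases hc : h = c
    · simp [run, hc]
    · have : (fun ω : Ω => run G h (marks ζ Θ ω) 0) ⁻¹' {c} = ∅ := by
        ext ω
        simp [run, hc]
      simp [this]
  | succ m ih =>
    have hmeas : ∀ g : V → ℕ, MeasurableSet ((fun ω => run G g (marks ζ Θ ω) m) ⁻¹' {c}) :=
      fun g => measurable_run hm.measurable_mark hm.measurable_shift g m (measurableSet_singleton c)
    have e1 : ∀ z, ζ ⁻¹' {z} ∩
        ((fun ω => run G h (marks ζ Θ ω) (m + 1)) ⁻¹' {c} ∩ Θ^[m + 1] ⁻¹' B) =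
        ζ ⁻¹' {z} ∩ Θ ⁻¹' ((fun ω => run G (jumpAt G h z) (marks ζ Θ ω) m) ⁻¹' {c} ∩
          Θ^[m] ⁻¹' B) := by
      intro z
      ext ω
      simp only [Set.mem_inter_iff, Set.mem_preimage, Set.mem_singleton_iff, run_marks_succ,
        Function.iterate_succ_apply]
      refine and_congr_right fun hz => ?_
      rw [hz]
    have e2 : ∀ z, ζ ⁻¹' {z} ∩ (fun ω => run G h (marks ζ Θ ω) (m + 1)) ⁻¹' {c} =
        ζ ⁻¹' {z} ∩ Θ ⁻¹' ((fun ω => run G (jumpAt G h z) (marks ζ Θ ω) m) ⁻¹' {c}) := by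
      intro z
      ext ω
      simp only [Set.mem_inter_iff, Set.mem_preimage, Set.mem_singleton_iff, run_marks_succ]
      refine and_congr_right fun hz => ?_
      rw [hz]
    rw [hm.measure_eq_sum, hm.measure_eq_sum ((fun ω => run G h (marks ζ Θ ω) (m + 1)) ⁻¹' {c}),
      Finset.sum_mul]
    refine Finset.sum_congr rfl fun z _ => ?_
    rw [e1, e2, hm.measure_inter _ _ ((hmeas _).inter ((hm.measurable_shift.iterate m) hB)),
      hm.measure_inter _ _ (hmeas _), ih, mul_assoc]

theorem indepFun_run [Nonempty V] [IsProbabilityMeasure μ] (hm : IsUniformMark μ ζ Θ) (m : ℕ)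
    (h : V → ℕ) : IndepFun (fun ω => run G h (marks ζ Θ ω) m) Θ^[m] μ := by
  have hr := measurable_run (G := G) hm.measurable_mark hm.measurable_shift h m
  rw [indepFun_iff_measure_inter_preimage_eq_mul]
  intro s t hs ht
  -- There are countably many configurations, so it is enough to compare the two measures on
  -- singletons.
  have e : (μ.restrict (Θ^[m] ⁻¹' t)).map (fun ω => run G h (marks ζ Θ ω) m) =
      μ t • μ.map (fun ω => run G h (marks ζ Θ ω) m) := by
    refine Measure.ext_of_singleton fun c => ?_
    have hc := hr (measurableSet_singleton c)
    rw [Measure.map_apply hr (measurableSet_singleton c), Measure.restrict_apply hc,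
      hm.measure_run_inter m h c ht, Measure.smul_apply, smul_eq_mul,
      Measure.map_apply hr (measurableSet_singleton c), mul_comm]
  have e' := congrArg (fun ν => ν s) e
  simp only [Measure.smul_apply, smul_eq_mul] at e'
  rw [Measure.map_apply hr hs, Measure.map_apply hr hs, Measure.restrict_apply (hr hs)] at e'
  rw [e', (hm.measurePreserving.iterate m).measure_preimage ht.nullMeasurableSet, mul_comm]

/-- The Markov property: on each event fixing the first mark, the remaining marks have the original
law, with total mass 1/n. -/
theorem integral_run [Nonempty V] [IsProbabilityMeasure μ] (hm : IsUniformMark μ ζ Θ)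
    (F : (V → ℕ) → ℝ) (k : ℕ) (h : V → ℕ) :
    Integrable (fun ω => F (run G h (marks ζ Θ ω) k)) μ ∧
      ∫ ω, F (run G h (marks ζ Θ ω) k) ∂μ = (avg G)^[k] F h := by
  induction k generalizing h with
  | zero => exact ⟨by simp [run], by simp [run]⟩
  | succ k ih =>
    have hF : Measurable F := measurable_of_countable F
    have hz : ∀ z : V, MeasurableSet (ζ ⁻¹' {z}) :=
      fun z => hm.measurable_mark (measurableSet_singleton z)
    have hU : (⋃ z, ζ ⁻¹' {z}) = Set.univ := by
      ext ω
      simp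
    have hmap : ∀ z : V, (μ.restrict (ζ ⁻¹' {z})).map Θ = (Fintype.card V : ENNReal)⁻¹ • μ := by
      intro z
      refine Measure.ext fun B hB => ?_
      rw [Measure.map_apply hm.measurable_shift hB,
        Measure.restrict_apply (hm.measurable_shift hB), Set.inter_comm,
        hm.measure_inter z B hB, Measure.smul_apply, smul_eq_mul]
    have hres : ∀ z : V, IntegrableOn (fun ω => F (run G h (marks ζ Θ ω) (k + 1))) (ζ ⁻¹' {z}) μ ∧
        ∫ ω in ζ ⁻¹' {z}, F (run G h (marks ζ Θ ω) (k + 1)) ∂μ =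
          (Fintype.card V : ℝ)⁻¹ * (avg G)^[k] F (jumpAt G h z) := by
      intro z
      obtain ⟨i1, i2⟩ := ih (jumpAt G h z)
      have hcongr : Set.EqOn ((fun ω => F (run G (jumpAt G h z) (marks ζ Θ ω) k)) ∘ Θ)
          (fun ω => F (run G h (marks ζ Θ ω) (k + 1))) (ζ ⁻¹' {z}) := by
        intro ω hω
        have hω' : ζ ω = z := hω
        simp only [Function.comp, run_marks_succ, hω']
      have hmeas : AEStronglyMeasurable (fun ω => F (run G (jumpAt G h z) (marks ζ Θ ω) k))
          ((μ.restrict (ζ ⁻¹' {z})).map Θ) :=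
        (hF.comp (measurable_run hm.measurable_mark hm.measurable_shift _ _)).aestronglyMeasurable
      constructor
      · refine IntegrableOn.congr_fun ?_ hcongr (hz z)
        rw [IntegrableOn, ← integrable_map_measure hmeas hm.measurable_shift.aemeasurable, hmap]
        exact i1.smul_measure (by simp)
      · rw [← setIntegral_congr_fun (hz z) hcongr]
        have := integral_map hm.measurable_shift.aemeasurable hmeas
        simp only [Function.comp]
        rw [← this, hmap, integral_smul_measure, i2]
        simp
    constructor
    · rw [← integrableOn_univ, ← hU, integrableOn_finite_iUnion]
      exact fun z => (hres z).1
    · rw [← setIntegral_univ, ← hU, integral_iUnion_fintype hz ?_ fun z => (hres z).1]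
      · rw [Finset.sum_congr rfl fun z _ => (hres z).2, Function.iterate_succ_apply', avg,
          ← Finset.mul_sum, div_eq_inv_mul]
      · intro a b hab
        refine Set.disjoint_left.2 fun ω h1 h2 => hab ?_
        rw [← show ζ ω = a from h1, ← show ζ ω = b from h2]

end IsUniformMark

end Marks

/-! ### Linear growth in the number of jumps -/

section Growth

set_option linter.unusedSectionVars false

variable {V : Type*} [Fintype V] [Nonempty V] {G : SimpleGraph V} {Ω : Type*}

/-- Subadditivity over complete blocks of length m; each of the k % m leftover jumps raises the
maximum by at most one. -/
theorem top_run_le_sum (ζ : Ω → V) (Θ : Ω → Ω) (ω : Ω) (m k : ℕ) :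
    top (run G 0 (marks ζ Θ ω) k) ≤
      ∑ i ∈ Finset.range (k / m), top (run G 0 (marks ζ Θ ((Θ^[m])^[i] ω)) m) + k % m := by
  have h1 : ∀ q, top (run G 0 (marks ζ Θ ω) (q * m)) ≤
      ∑ i ∈ Finset.range q, top (run G 0 (marks ζ Θ ((Θ^[m])^[i] ω)) m) := by
    intro q
    induction q with
    | zero =>
      simp only [Nat.zero_mul, run]
      exact top_le fun _ => Nat.zero_le _
    | succ q ih =>
      rw [Finset.sum_range_succ, Nat.succ_mul, ← Function.iterate_mul, marks_iterate,
        Nat.mul_comm m q]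
      exact (top_run_add_le _ _ _).trans (Nat.add_le_add_right ih _)
  have h2 : k = (k / m) * m + k % m := by rw [Nat.mul_comm]; exact (Nat.div_add_mod k m).symm
  conv_lhs => rw [h2]
  rw [run_add]
  exact (top_le (run_le_top _ _ _)).trans (Nat.add_le_add_right (h1 _) _)

theorem sum_le_bot_run (ζ : Ω → V) (Θ : Ω → Ω) (ω : Ω) (m k : ℕ) :
    ∑ i ∈ Finset.range (k / m), bot (run G 0 (marks ζ Θ ((Θ^[m])^[i] ω)) m) ≤
      bot (run G 0 (marks ζ Θ ω) k) := by
  have h1 : ∀ q, ∑ i ∈ Finset.range q, bot (run G 0 (marks ζ Θ ((Θ^[m])^[i] ω)) m) ≤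
      bot (run G 0 (marks ζ Θ ω) (q * m)) := by
    intro q
    induction q with
    | zero => simp
    | succ q ih =>
      rw [Finset.sum_range_succ, Nat.succ_mul, ← Function.iterate_mul, marks_iterate,
        Nat.mul_comm m q]
      exact (Nat.add_le_add_right ih _).trans (bot_run_add_ge _ _ _)
  have h2 : k = (k / m) * m + k % m := by rw [Nat.mul_comm]; exact (Nat.div_add_mod k m).symm
  conv_rhs => rw [h2]
  rw [run_add]
  exact (h1 _).trans (le_bot fun x => (bot_le _ x).trans (le_run _ _ _ x))

variable [MeasurableSpace V] [MeasurableSingletonClass V] [MeasurableSpace Ω] {μ : Measure Ω}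
  [IsProbabilityMeasure μ] {ζ : Ω → V} {Θ : Ω → Ω}

/-- The strong law applied to the i.i.d. extremal heights of blocks of length m, each block
restarted from the flat configuration. -/
theorem IsUniformMark.ae_le_bot_and_top_le (hm : IsUniformMark μ ζ Θ) {m : ℕ} (hm0 : 0 < m) :
    ∀ᵐ ω ∂μ, ∀ ε > 0, ∀ᶠ k : ℕ in atTop,
      (avg G)^[m] (fun h => (bot h : ℝ)) 0 / m - ε ≤ (bot (run G 0 (marks ζ Θ ω) k) : ℝ) / k ∧
      (top (run G 0 (marks ζ Θ ω) k) : ℝ) / k ≤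
        (avg G)^[m] (fun h => (top h : ℝ)) 0 / m + ε := by
  have key : ∀ F : (V → ℕ) → ℝ, ∀ᵐ ω ∂μ, Tendsto (fun n : ℕ =>
      (∑ i ∈ Finset.range n, F (run G 0 (marks ζ Θ ((Θ^[m])^[i] ω)) m)) / n) atTop
      (𝓝 ((avg G)^[m] F 0)) := by
    intro F
    obtain ⟨h1, h2⟩ := hm.integral_run (G := G) F m 0
    rw [← h2]
    exact strong_law_of_indepFun (hm.measurePreserving.iterate m)
      ((measurable_of_countable F).comp (measurable_run hm.measurable_mark hm.measurable_shift 0 m))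
      h1 ((hm.indepFun_run m 0).comp (measurable_of_countable F) measurable_id)
  filter_upwards [key fun h => (bot h : ℝ), key fun h => (top h : ℝ)] with ω hb ht ε hε
  have hb' := tendsto_div_of_tendsto_div hb hm0
  have ht' := tendsto_div_of_tendsto_div ht hm0
  have hr : Tendsto (fun k : ℕ => (m : ℝ) / k) atTop (𝓝 0) :=
    tendsto_const_div_atTop_nhds_zero_nat _
  filter_upwards [hb'.eventually (lt_mem_nhds (sub_lt_self _ hε)),
    ht'.eventually (gt_mem_nhds (lt_add_of_pos_right _ (half_pos hε))),
    hr.eventually (gt_mem_nhds (half_pos hε)), eventually_gt_atTop 0] with k h1 h2 h3 hk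
  have hk' : (0 : ℝ) < k := Nat.cast_pos.2 hk
  constructor
  · refine h1.le.trans (div_le_div_of_nonneg_right ?_ hk'.le)
    exact_mod_cast sum_le_bot_run (G := G) ζ Θ ω m k
  · have h4 : (top (run G 0 (marks ζ Θ ω) k) : ℝ) ≤
        (∑ i ∈ Finset.range (k / m), (top (run G 0 (marks ζ Θ ((Θ^[m])^[i] ω)) m) : ℝ)) + m := by
      have h5 := top_run_le_sum (G := G) ζ Θ ω m k
      have h6 := (Nat.mod_lt k hm0).le
      exact_mod_cast h5.trans (Nat.add_le_add_left h6 _)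
    have h7 := div_le_div_of_nonneg_right h4 hk'.le
    rw [add_div] at h7
    linarith

/-- The maximal and the minimal heights after `k` jumps grow linearly with the same speed, and
this speed is at least the drift of any potential dominated by the maximal height. -/
theorem IsUniformMark.exists_growth (hm : IsUniformMark μ ζ Θ) (hG : G.Connected) :
    ∃ g : ℝ, (∀ᵐ ω ∂μ,
      Tendsto (fun k : ℕ => (top (run G 0 (marks ζ Θ ω) k) : ℝ) / k) atTop (𝓝 g) ∧
      Tendsto (fun k : ℕ => (bot (run G 0 (marks ζ Θ ω) k) : ℝ) / k) atTop (𝓝 g)) ∧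
      ∀ (F : (V → ℕ) → ℝ) (δ C : ℝ), (∀ h, F h ≤ top h + C) → (∀ h, F h + δ ≤ avg G F h) →
        δ ≤ g := by
  obtain ⟨L, hL, C, hC⟩ := exists_gap_bound hG
  have hmpos : ∀ j : ℕ, 0 < (j + 1) * L := fun j => Nat.mul_pos j.succ_pos hL
  set a : ℕ → ℝ := fun j =>
    (avg G)^[(j + 1) * L] (fun h => (top h : ℝ)) 0 / ((j + 1) * L : ℕ) with ha
  set b : ℕ → ℝ := fun j =>
    (avg G)^[(j + 1) * L] (fun h => (bot h : ℝ)) 0 / ((j + 1) * L : ℕ) with hb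
  have hall : ∀ᵐ ω ∂μ, ∀ j, ∀ ε > 0, ∀ᶠ k : ℕ in atTop,
      b j - ε ≤ (bot (run G 0 (marks ζ Θ ω) k) : ℝ) / k ∧
      (top (run G 0 (marks ζ Θ ω) k) : ℝ) / k ≤ a j + ε :=
    ae_all_iff.2 fun j => hm.ae_le_bot_and_top_le (hmpos j)
  have hbt : ∀ (ω : Ω) (k : ℕ), (bot (run G 0 (marks ζ Θ ω) k) : ℝ) / k ≤
      (top (run G 0 (marks ζ Θ ω) k) : ℝ) / k := by
    intro ω k
    refine div_le_div_of_nonneg_right ?_ (Nat.cast_nonneg _)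
    obtain ⟨v⟩ := ‹Nonempty V›
    exact_mod_cast (bot_le _ v).trans (le_top _ v)
  have hba : ∀ i j, b i ≤ a j := by
    obtain ⟨ω, hω⟩ := hall.exists
    intro i j
    refine le_of_forall_pos_le_add fun ε hε => ?_
    obtain ⟨k, h1, h2⟩ := ((hω i (ε / 2) (half_pos hε)).and (hω j (ε / 2) (half_pos hε))).exists
    have := hbt ω k
    linarith [h1.1, h2.2]
  have hgap : ∀ j, a j - b j ≤ C / ((j + 1) * L : ℕ) := by
    intro j
    have h1 := hC (j + 1)
    have h2 := avg_iterate_add (G := G) (fun h => (top h : ℝ) - bot h) (fun h => (bot h : ℝ))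
      ((j + 1) * L)
    simp only [sub_add_cancel] at h2
    rw [ha, hb]
    simp only
    rw [← sub_div]
    refine div_le_div_of_nonneg_right ?_ (Nat.cast_nonneg _)
    rw [h2]
    linarith
  have hinv : ∀ D : ℝ, Tendsto (fun j : ℕ => D / ((j + 1) * L : ℕ)) atTop (𝓝 0) := by
    intro D
    refine (tendsto_const_div_atTop_nhds_zero_nat D).comp (tendsto_atTop_mono (fun j => ?_)
      tendsto_id)
    exact (Nat.le_succ j).trans (Nat.le_mul_of_pos_right _ hL)
  have hbdd : BddBelow (Set.range a) := ⟨b 0, by rintro _ ⟨j, rfl⟩; exact hba 0 j⟩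
  set g := ⨅ j, a j with hg
  have hga : ∀ j, g ≤ a j := fun j => ciInf_le hbdd j
  have hbg : ∀ j, b j ≤ g := fun j => le_ciInf (hba j)
  refine ⟨g, ?_, ?_⟩
  · filter_upwards [hall] with ω hω
    have h1 : ∀ ε > 0, ∀ᶠ k : ℕ in atTop,
        g - ε ≤ (bot (run G 0 (marks ζ Θ ω) k) : ℝ) / k ∧
        (top (run G 0 (marks ζ Θ ω) k) : ℝ) / k ≤ g + ε := by
      intro ε hε
      obtain ⟨j, hj⟩ := ((hinv C).eventually (gt_mem_nhds (half_pos hε))).exists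
      have h2 := hgap j
      have h3 := hga j
      have h4 := hbg j
      filter_upwards [hω j (ε / 2) (half_pos hε)] with k hk
      constructor <;> linarith [hk.1, hk.2]
    constructor
    · refine tendsto_order.2 ⟨fun c hc => ?_, fun c hc => ?_⟩
      · filter_upwards [h1 ((g - c) / 2) (by linarith)] with k hk
        linarith [hk.1, hbt ω k]
      · filter_upwards [h1 ((c - g) / 2) (by linarith)] with k hk
        linarith [hk.2]
    · refine tendsto_order.2 ⟨fun c hc => ?_, fun c hc => ?_⟩
      · filter_upwards [h1 ((g - c) / 2) (by linarith)] with k hk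
        linarith [hk.1]
      · filter_upwards [h1 ((c - g) / 2) (by linarith)] with k hk
        linarith [hk.2, hbt ω k]
  · intro F δ C' h1 h2
    -- After m jumps the mean of F has grown by at least mδ, while the mean maximum is at most mg +
    -- C by the gap bound.
    have h3 : ∀ j : ℕ, δ ≤ g + (C + C' - F 0) / ((j + 1) * L : ℕ) := by
      intro j
      have hpos : (0 : ℝ) < ((j + 1) * L : ℕ) := Nat.cast_pos.2 (hmpos j)
      have e1 := add_le_avg_iterate (G := G) h2 ((j + 1) * L) 0
      have e2 : F ≤ fun h => 1 * (top h : ℝ) + C' := fun h => by simpa using h1 h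
      have e3 := avg_iterate_mono (G := G) e2 ((j + 1) * L) 0
      rw [avg_iterate_affine] at e3
      have e4 : (avg G)^[(j + 1) * L] (fun h => (top h : ℝ)) 0 = a j * ((j + 1) * L : ℕ) := by
        rw [ha]
        simp only
        rw [div_mul_cancel₀ _ hpos.ne']
      have e5 := hgap j
      have e6 := hbg j
      have e7 : δ * ((j + 1) * L : ℕ) ≤ a j * ((j + 1) * L : ℕ) + (C' - F 0) := by
        simp only [e4] at e3
        linarith
      have e8 : δ ≤ a j + (C' - F 0) / ((j + 1) * L : ℕ) := by
        rw [← sub_le_iff_le_add', le_div_iff₀ hpos]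
        linarith
      have e9 : (C + C' - F 0) / ((j + 1) * L : ℕ) =
          C / ((j + 1) * L : ℕ) + (C' - F 0) / ((j + 1) * L : ℕ) := by ring
      linarith
    have h4 := ((hinv (C + C' - F 0)).const_add g)
    rw [add_zero] at h4
    exact ge_of_tendsto' h4 h3

end Growth

/-! ### The unit exponential distribution -/

section Exponential

open scoped ENNReal

theorem lintegral_expMeasure_one {f : ℝ → ℝ≥0∞} (hf : Measurable f) :
    ∫⁻ t, f t ∂(expMeasure 1) = ∫⁻ t in Set.Ioi 0, ENNReal.ofReal (Real.exp (-t)) * f t := by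
  have h1 : expMeasure 1 = volume.withDensity (exponentialPDF 1) := rfl
  have hm : Measurable (exponentialPDF 1) := (measurable_exponentialPDFReal 1).ennreal_ofReal
  rw [h1, lintegral_withDensity_eq_lintegral_mul _ hm hf,
    ← lintegral_indicator measurableSet_Ioi]
  refine lintegral_congr_ae ?_
  filter_upwards [compl_mem_ae_iff.2 (Real.volume_singleton (a := (0 : ℝ)))] with t ht
  have ht : t ≠ 0 := ht
  by_cases h : 0 < t
  · simp [Set.indicator, h, exponentialPDF_eq, h.le]
  · have h' : ¬ 0 ≤ t := fun h0 => h (lt_of_le_of_ne h0 ht.symm)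
    simp [Set.indicator, h, exponentialPDF_eq, h']

theorem ae_expMeasure_pos : ∀ᵐ t ∂(expMeasure 1), 0 < t := by
  rw [ae_iff]
  have hm : MeasurableSet {t : ℝ | ¬ 0 < t} := measurableSet_Ioi.compl
  rw [← lintegral_indicator_one hm, lintegral_expMeasure_one (measurable_one.indicator hm)]
  refine (setLIntegral_congr_fun (g := 0) measurableSet_Ioi fun t ht => ?_).trans (by simp)
  have : (0 : ℝ) < t := ht
  simp [Set.indicator, this]

/-- The exponential distribution has no memory. -/
theorem lintegral_expMeasure_sub {t : ℝ} (ht : 0 ≤ t) {f : ℝ → ℝ≥0∞} (hf : Measurable f) :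
    ∫⁻ u, (Set.Ioi t).indicator (fun u => f (u - t)) u ∂(expMeasure 1) =
      ENNReal.ofReal (Real.exp (-t)) * ∫⁻ u, f u ∂(expMeasure 1) := by
  have hft : Measurable fun u => f (u - t) := hf.comp (measurable_id.sub_const t)
  rw [lintegral_expMeasure_one (hft.indicator measurableSet_Ioi), lintegral_expMeasure_one hf,
    ← lintegral_const_mul _ (by fun_prop), ← lintegral_indicator measurableSet_Ioi,
    ← lintegral_indicator measurableSet_Ioi,
    ← lintegral_sub_right_eq_self ((Set.Ioi (0 : ℝ)).indicator fun u =>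
      ENNReal.ofReal (Real.exp (-t)) * (ENNReal.ofReal (Real.exp (-u)) * f u)) t]
  refine lintegral_congr fun u => ?_
  by_cases hu : t < u
  · have h0 : 0 < u := ht.trans_lt hu
    simp only [Set.indicator, Set.mem_Ioi, hu, h0, sub_pos, if_true]
    rw [← mul_assoc, ← ENNReal.ofReal_mul (Real.exp_pos _).le, ← Real.exp_add]
    congr 3
    ring
  · simp [Set.indicator, hu]

/-- The probability that one exponential clock rings before m others. -/
theorem lintegral_exp_pow (m : ℕ) :
    ∫⁻ t, ENNReal.ofReal (Real.exp (-t)) ^ m ∂(expMeasure 1) = ((m + 1 : ℕ) : ℝ≥0∞)⁻¹ := by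
  rw [lintegral_expMeasure_one (by fun_prop)]
  have h1 : ∀ t : ℝ, ENNReal.ofReal (Real.exp (-t)) * ENNReal.ofReal (Real.exp (-t)) ^ m =
      ENNReal.ofReal (Real.exp (-(m + 1 : ℝ) * t)) := by
    intro t
    rw [← pow_succ', ← ENNReal.ofReal_pow (Real.exp_pos _).le, ← Real.exp_nat_mul]
    congr 2
    push_cast
    ring
  simp only [h1]
  have hpos : (0 : ℝ) < m + 1 := by positivity
  rw [← ofReal_integral_eq_lintegral_ofReal
    (integrableOn_exp_mul_Ioi (by linarith) 0) (ae_of_all _ fun _ => (Real.exp_pos _).le),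
    integral_exp_mul_Ioi (by linarith)]
  simp only [mul_zero, Real.exp_zero, neg_div_neg_eq]
  rw [one_div, ENNReal.ofReal_inv_of_pos hpos]
  congr 1
  exact_mod_cast ENNReal.ofReal_natCast (m + 1)

/-- The mean of the ringing time on the event that this clock beats m others; summed over n = m + 1
clocks it gives the mean 1/n of the first jump time. -/
theorem lintegral_mul_exp_pow (m : ℕ) :
    ∫⁻ t, ENNReal.ofReal t * ENNReal.ofReal (Real.exp (-t)) ^ m ∂(expMeasure 1) =
      ((m + 1 : ℕ) : ℝ≥0∞)⁻¹ ^ 2 := by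
  rw [lintegral_expMeasure_one (by fun_prop)]
  have hpos : (0 : ℝ) < m + 1 := by positivity
  have h1 : ∀ t ∈ Set.Ioi (0 : ℝ), ENNReal.ofReal (Real.exp (-t)) *
      (ENNReal.ofReal t * ENNReal.ofReal (Real.exp (-t)) ^ m) =
      ENNReal.ofReal (t ^ ((2 : ℝ) - 1) * Real.exp (-((m + 1 : ℝ) * t))) := by
    intro t ht
    have ht : (0 : ℝ) < t := ht
    rw [mul_left_comm, ← pow_succ', ← ENNReal.ofReal_pow (Real.exp_pos _).le, ← Real.exp_nat_mul,
      ← ENNReal.ofReal_mul ht.le]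
    congr 2
    · norm_num
    · congr 1
      push_cast
      ring
  rw [setLIntegral_congr_fun measurableSet_Ioi h1]
  have hval := Real.integral_rpow_mul_exp_neg_mul_Ioi (a := 2) (r := (m + 1 : ℝ)) (by norm_num) hpos
  -- A non-integrable function would have integral 0, contradicting the positive value just found.
  have hint : IntegrableOn (fun t : ℝ => t ^ ((2 : ℝ) - 1) * Real.exp (-((m + 1 : ℝ) * t)))
      (Set.Ioi 0) := by
    by_contra hcon
    rw [integral_undef hcon] at hval
    have : (0 : ℝ) < (1 / (m + 1 : ℝ)) ^ (2 : ℝ) * Real.Gamma 2 :=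
      mul_pos (by positivity) (Real.Gamma_pos_of_pos (by norm_num))
    linarith
  rw [← ofReal_integral_eq_lintegral_ofReal hint, hval]
  · rw [Real.Gamma_two, mul_one, one_div, Real.rpow_two, ENNReal.ofReal_pow (by positivity),
      ENNReal.ofReal_inv_of_pos hpos]
    congr 2
    exact_mod_cast ENNReal.ofReal_natCast (m + 1)
  · refine (ae_restrict_iff' measurableSet_Ioi).2 (ae_of_all _ fun t ht => ?_)
    have ht : (0 : ℝ) < t := ht
    simp only [Pi.zero_apply]
    positivity

end Exponential

/-! ### One Poisson process: head, tail and loss of memory -/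

section OneClock

open scoped ENNReal

/-- The law of the waiting times of one Poisson process. -/
noncomputable abbrev clockLaw : Measure (ℕ → ℝ) := Measure.infinitePi fun _ : ℕ => expMeasure 1

/-- The sequence with first term `p.1` and remaining terms `p.2`. -/
def seqCons (p : ℝ × (ℕ → ℝ)) (i : ℕ) : ℝ := Nat.casesOn i p.1 p.2

/-- Reduce the first term of a sequence by `t`. -/
def subHead (t : ℝ) (w : ℕ → ℝ) (i : ℕ) : ℝ := if i = 0 then w 0 - t else w i

theorem measurable_seqCons : Measurable seqCons := by
  refine measurable_pi_lambda _ fun i => ?_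
  cases i with
  | zero => exact measurable_fst
  | succ i => exact (measurable_pi_apply i).comp measurable_snd

theorem measurable_subHead : Measurable fun p : ℝ × (ℕ → ℝ) => subHead p.1 p.2 := by
  refine measurable_pi_lambda _ fun i => ?_
  unfold subHead
  split_ifs
  · exact ((measurable_pi_apply 0).comp measurable_snd).sub measurable_fst
  · exact (measurable_pi_apply i).comp measurable_snd

theorem subHead_seqCons (t u : ℝ) (w : ℕ → ℝ) :
    subHead t (seqCons (u, w)) = seqCons (u - t, w) := by
  funext i
  cases i <;> simp [subHead, seqCons]

theorem map_seqCons : ((expMeasure 1).prod clockLaw).map seqCons = clockLaw := by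
  refine Measure.eq_infinitePi _ fun s t ht => ?_
  classical
  have hs : MeasurableSet (Set.pi (s : Set ℕ) t) :=
    MeasurableSet.pi s.countable_toSet fun i _ => ht i
  rw [Measure.map_apply measurable_seqCons hs]
  -- The cylinder is padded with trivial conditions to an initial segment of indices, so that it
  -- splits into a condition on the head and one on the tail.
  set N := s.sup id + 1 with hN
  set t' : ℕ → Set ℝ := fun i => if i ∈ s then t i else Set.univ with ht'
  have ht'm : ∀ i, MeasurableSet (t' i) := by
    intro i
    simp only [ht']
    split_ifs
    exacts [ht i, MeasurableSet.univ]
  have hsub : s ⊆ Finset.range (N + 1) := fun i hi =>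
    Finset.mem_range.2 (by have := Finset.le_sup (f := id) hi; simp only [id] at this; omega)
  have e1 : seqCons ⁻¹' (Set.pi (s : Set ℕ) t) =
      t' 0 ×ˢ Set.pi (Finset.range N : Set ℕ) (fun i => t' (i + 1)) := by
    ext p
    simp only [Set.mem_preimage, Set.mem_pi, Set.mem_prod, Finset.mem_coe, Finset.mem_range, ht']
    constructor
    · intro h
      refine ⟨?_, fun i _ => ?_⟩
      · split_ifs with h0
        exacts [h 0 h0, trivial]
      · split_ifs with h0
        exacts [h (i + 1) h0, trivial]
    · rintro ⟨h0, h1⟩ i hi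
      cases i with
      | zero => simpa [hi, seqCons] using h0
      | succ i =>
        have := h1 i (by have := Finset.mem_range.1 (hsub hi); omega)
        simpa [hi, seqCons] using this
  rw [e1, Measure.prod_prod, Measure.infinitePi_pi _ fun i _ => ht'm _,
    mul_comm, ← Finset.prod_range_succ' (fun i => expMeasure 1 (t' i))]
  rw [← Finset.prod_subset hsub fun i _ hi => by simp [ht', hi]]
  exact Finset.prod_congr rfl fun i hi => by simp [ht', hi]

theorem lintegral_clockLaw {f : (ℕ → ℝ) → ℝ≥0∞} (hf : Measurable f) :
    ∫⁻ w, f w ∂clockLaw = ∫⁻ t, ∫⁻ w, f (seqCons (t, w)) ∂clockLaw ∂(expMeasure 1) := by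
  conv_lhs => rw [← map_seqCons]
  rw [lintegral_map hf measurable_seqCons]
  exact lintegral_prod _ (hf.comp measurable_seqCons).aemeasurable

/-- A clock that has not rung by time t starts afresh: only the head is conditioned, and it has no
memory. -/
theorem clockLaw_subHead {t : ℝ} (ht : 0 ≤ t) {S : Set (ℕ → ℝ)} (hS : MeasurableSet S) :
    clockLaw {w | t < w 0 ∧ subHead t w ∈ S} = ENNReal.ofReal (Real.exp (-t)) * clockLaw S := by
  have hsub : Measurable (subHead t) := measurable_subHead.comp (measurable_const.prodMk measurable_id)
  have hm : MeasurableSet {w : ℕ → ℝ | t < w 0 ∧ subHead t w ∈ S} :=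
    (measurableSet_lt measurable_const (measurable_pi_apply 0)).inter (hsub hS)
  rw [← lintegral_indicator_one hm, ← lintegral_indicator_one hS,
    lintegral_clockLaw (measurable_one.indicator hm),
    lintegral_clockLaw (measurable_one.indicator hS), ← lintegral_expMeasure_sub ht]
  · refine lintegral_congr fun u => ?_
    by_cases hu : t < u
    · simp only [Set.indicator, Set.mem_Ioi, hu, if_true, Set.mem_ofPred_eq, subHead_seqCons]
      refine lintegral_congr fun w => ?_
      have : t < seqCons (u, w) 0 := hu
      have e : (t < seqCons (u, w) 0 ∧ subHead t (seqCons (u, w)) ∈ S) ↔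
          seqCons (u - t, w) ∈ S := by
        rw [subHead_seqCons]
        exact and_iff_right this
      by_cases h : seqCons (u - t, w) ∈ S
      · rw [if_pos (e.2 h), if_pos h]
        rfl
      · rw [if_neg (mt e.1 h), if_neg h]
    · simp only [Set.indicator, Set.mem_Ioi, hu, if_false, Set.mem_ofPred_eq]
      refine (lintegral_congr fun w => ?_).trans lintegral_zero
      have : ¬ t < seqCons (u, w) 0 := hu
      exact if_neg fun h => this h.1
  · exact ((measurable_one.indicator hS).comp measurable_seqCons).lintegral_prod_right'

end OneClock

/-! ### The first jump: its place, its time, and renewal afterwards -/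

section FirstJump

set_option linter.unusedSectionVars false

open scoped ENNReal

variable {V : Type*}

/-- The process attached to `z` is the only one that makes the first jump. -/
def JumpsFirst (ω : Sample V) (z : V) : Prop := ∀ y, y ≠ z → ω z 0 < ω y 0

theorem JumpsFirst.eq {ω : Sample V} {z z' : V} (h : JumpsFirst ω z) (h' : JumpsFirst ω z') :
    z = z' := by
  by_contra hne
  exact lt_asymm (h z' (Ne.symm hne)) (h' z hne)

open Classical in
/-- The waiting times seen after the first jump, when this is a jump at `z`. -/
noncomputable def dropAt (z : V) (ω : Sample V) : Sample V := fun x =>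
  if x = z then fun i => ω x (i + 1) else subHead (ω z 0) (ω x)

open Classical in
/-- The vertex at which the first jump occurs. -/
noncomputable def firstMark [Nonempty V] (ω : Sample V) : V :=
  if h : ∃ z, JumpsFirst ω z then h.choose else Classical.arbitrary V

/-- The time of the first jump. -/
noncomputable def firstTime [Nonempty V] (ω : Sample V) : ℝ := ω (firstMark ω) 0

/-- The waiting times seen after the first jump. -/
noncomputable def dropFirst [Nonempty V] (ω : Sample V) : Sample V := dropAt (firstMark ω) ω

theorem JumpsFirst.firstMark_eq [Nonempty V] {ω : Sample V} {z : V} (h : JumpsFirst ω z) :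
    firstMark ω = z := by
  have h' : ∃ z, JumpsFirst ω z := ⟨z, h⟩
  rw [firstMark, dif_pos h']
  exact h'.choose_spec.eq h

variable [Fintype V]

theorem measurable_dropAt (z : V) : Measurable (dropAt z : Sample V → Sample V) := by
  refine measurable_pi_lambda _ fun x => ?_
  by_cases hx : x = z
  · simp only [dropAt, hx, if_true]
    fun_prop
  · simp only [dropAt, hx, if_false]
    exact measurable_subHead.comp (f := fun ω : Sample V => (ω z 0, ω x)) (by fun_prop)

theorem measurableSet_jumpsFirst (z : V) : MeasurableSet {ω : Sample V | JumpsFirst ω z} := by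
  unfold JumpsFirst
  measurability

/-- The measure of the event that the first jump occurs at `z`, at a time in `A`, and
the waiting times seen afterwards lie in a box. -/
theorem poissonLaw_jumpsFirst_box (z : V) {A : Set ℝ} (hA : MeasurableSet A)
    {s : V → Set (ℕ → ℝ)} (hs : ∀ x, MeasurableSet (s x)) :
    poissonLaw V ({ω | JumpsFirst ω z} ∩ {ω | ω z 0 ∈ A} ∩ dropAt z ⁻¹' Set.pi Set.univ s) =
      (∫⁻ t in A, ENNReal.ofReal (Real.exp (-t)) ^ (Fintype.card V - 1) ∂(expMeasure 1)) *
        ∏ x, clockLaw (s x) := by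
  classical
  set W := {ω : Sample V | JumpsFirst ω z} ∩ {ω | ω z 0 ∈ A} ∩ dropAt z ⁻¹' Set.pi Set.univ s
  have hW : MeasurableSet W := by
    refine ((measurableSet_jumpsFirst z).inter ?_).inter
      (measurable_dropAt z (MeasurableSet.univ_pi hs))
    have : Measurable fun ω : Sample V => ω z 0 := by fun_prop
    exact this hA
  set φ : ℝ → ℝ≥0∞ := fun t => ENNReal.ofReal (Real.exp (-t)) with hφ
  have hφm : Measurable φ := by fun_prop
  set D : Set (ℕ → ℝ) := {w | w 0 ∈ A ∧ (fun i => w (i + 1)) ∈ s z} with hD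
  have hDm : MeasurableSet D := by
    have h1 : Measurable fun w : ℕ → ℝ => w 0 := by fun_prop
    have h2 : Measurable fun (w : ℕ → ℝ) (i : ℕ) => w (i + 1) := by fun_prop
    exact (h1 hA).inter (h2 (hs z))
  set c : ℝ≥0∞ := ∏ y : {y // ¬ y = z}, clockLaw (s y) with hc
  have hcard : Fintype.card {y // ¬ y = z} = Fintype.card V - 1 := by
    rw [Fintype.card_subtype_compl, Fintype.card_subtype_eq]
  -- The clock of z is separated from the others. Given its first ring t, each of the n - 1 other
  -- clocks independently contributes a memoryless factor exp(-t).
  have e0 := (measurePreserving_piEquivPiSubtypeProd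
    (fun _ : V => clockLaw) (fun x => x = z)).symm
  have e1 := e0.measure_preimage hW.nullMeasurableSet
  have e2 : poissonLaw V = Measure.pi fun _ : V => clockLaw := rfl
  have hpos : ∀ᵐ w ∂clockLaw, (0 : ℝ) < w 0 :=
    (measurePreserving_eval_infinitePi (fun _ : ℕ => expMeasure 1) 0).quasiMeasurePreserving.ae
      ae_expMeasure_pos
  rw [e2, ← e1, Measure.prod_apply (e0.measurable hW)]
  have e3 : ∀ p : {x // x = z} → ℕ → ℝ, 0 < p ⟨z, rfl⟩ 0 →
      (Measure.pi fun _ : {y // ¬ y = z} => clockLaw) (Prod.mk p ⁻¹'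
        ((MeasurableEquiv.piEquivPiSubtypeProd (fun _ : V => ℕ → ℝ) fun x => x = z).symm ⁻¹' W)) =
      D.indicator (fun w => φ (w 0) ^ (Fintype.card V - 1) * c) (p ⟨z, rfl⟩) := by
    intro p hp
    have e4 : Prod.mk p ⁻¹'
        ((MeasurableEquiv.piEquivPiSubtypeProd (fun _ : V => ℕ → ℝ) fun x => x = z).symm ⁻¹' W) =
        {q | p ⟨z, rfl⟩ ∈ D ∧ q ∈ Set.pi Set.univ fun y : {y // ¬ y = z} =>
          {w | p ⟨z, rfl⟩ 0 < w 0 ∧ subHead (p ⟨z, rfl⟩ 0) w ∈ s y}} := by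
      ext q
      set ω := (MeasurableEquiv.piEquivPiSubtypeProd (fun _ : V => ℕ → ℝ) fun x => x = z).symm
        (p, q) with hω
      have f1 : ω z = p ⟨z, rfl⟩ := by
        simp [hω, MeasurableEquiv.piEquivPiSubtypeProd, Equiv.piEquivPiSubtypeProd]
      have f2 : ∀ y (hy : ¬ y = z), ω y = q ⟨y, hy⟩ := by
        intro y hy
        simp [hω, MeasurableEquiv.piEquivPiSubtypeProd, Equiv.piEquivPiSubtypeProd, hy]
      change ω ∈ W ↔ _
      constructor
      · rintro ⟨⟨h1, h2⟩, h3⟩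
        have h3' : ∀ x, dropAt z ω x ∈ s x := fun x => h3 x trivial
        refine ⟨⟨?_, ?_⟩, ?_⟩
        · rw [← f1]; exact h2
        · have := h3' z
          rwa [dropAt, if_pos rfl, f1] at this
        · rintro ⟨y, hy⟩ -
          have h4 := h1 y hy
          have h5 := h3' y
          rw [dropAt, if_neg hy, f1, f2 y hy] at h5
          rw [f1, f2 y hy] at h4
          exact ⟨h4, h5⟩
      · rintro ⟨⟨h1, h2⟩, h3⟩
        refine ⟨⟨fun y hy => ?_, ?_⟩, fun x _ => ?_⟩
        · rw [f1, f2 y hy]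
          exact (h3 ⟨y, hy⟩ trivial).1
        · change ω z 0 ∈ A
          rw [f1]; exact h1
        · by_cases hx : x = z
          · subst hx
            rw [dropAt, if_pos rfl, f1]
            exact h2
          · rw [dropAt, if_neg hx, f1, f2 x hx]
            exact (h3 ⟨x, hx⟩ trivial).2
    rw [e4]
    by_cases hpD : p ⟨z, rfl⟩ ∈ D
    · simp only [hpD, true_and, Set.indicator_of_mem]
      change (Measure.pi fun _ : {y // ¬ y = z} => clockLaw) (Set.pi Set.univ _) = _
      rw [Measure.pi_pi, Finset.prod_congr rfl fun (y : {y // ¬ y = z}) _ => clockLaw_subHead hp.le (hs (y : V)),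
        Finset.prod_mul_distrib, Finset.prod_const, Finset.card_univ, hcard]
    · simp [hpD]
  have hgm : Measurable (D.indicator fun w : ℕ → ℝ => φ (w 0) ^ (Fintype.card V - 1) * c) :=
    Measurable.indicator (by fun_prop) hDm
  have hev : MeasurePreserving (Function.eval ⟨z, rfl⟩)
      (@Measure.pi {x // x = z} (fun _ => ℕ → ℝ) (Subtype.fintype _) _ fun _ => clockLaw)
      clockLaw :=
    @measurePreserving_eval {x // x = z} (fun _ => ℕ → ℝ) (Subtype.fintype _) _
      (fun _ => clockLaw) _ ⟨z, rfl⟩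
  rw [lintegral_congr_ae (g := fun p : {x // x = z} → ℕ → ℝ =>
    D.indicator (fun w => φ (w 0) ^ (Fintype.card V - 1) * c) (p ⟨z, rfl⟩))
    ((hev.quasiMeasurePreserving.ae hpos).mono e3), hev.lintegral_comp hgm,
    lintegral_clockLaw hgm]
  have e5 : ∀ t, ∫⁻ w, D.indicator (fun w => φ (w 0) ^ (Fintype.card V - 1) * c)
      (seqCons (t, w)) ∂clockLaw =
      A.indicator (fun t => φ t ^ (Fintype.card V - 1)) t * (c * clockLaw (s z)) := by
    intro t
    by_cases ht : t ∈ A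
    · rw [Set.indicator_of_mem ht, ← mul_assoc, ← lintegral_indicator_const (hs z)]
      refine lintegral_congr fun w => ?_
      by_cases hw : w ∈ s z
      · rw [Set.indicator_of_mem hw, Set.indicator_of_mem (show seqCons (t, w) ∈ D from ⟨ht, hw⟩)]
        rfl
      · rw [Set.indicator_of_notMem hw, Set.indicator_of_notMem fun h => hw h.2]
    · rw [Set.indicator_of_notMem ht, zero_mul]
      refine (lintegral_congr fun w => ?_).trans lintegral_zero
      exact Set.indicator_of_notMem (fun h => ht h.1) _
  rw [lintegral_congr e5, lintegral_mul_const _ (Measurable.indicator (by fun_prop) hA),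
    lintegral_indicator hA]
  congr 1
  rw [Fintype.prod_eq_mul_prod_subtype_ne _ z, mul_comm]

/-- The first jump occurs at `z` with a density that does not depend on what happens afterwards. -/
theorem poissonLaw_jumpsFirst (z : V) {A : Set ℝ} (hA : MeasurableSet A)
    {B : Set (Sample V)} (hB : MeasurableSet B) :
    poissonLaw V ({ω | JumpsFirst ω z} ∩ {ω | ω z 0 ∈ A} ∩ dropAt z ⁻¹' B) =
      (∫⁻ t in A, ENNReal.ofReal (Real.exp (-t)) ^ (Fintype.card V - 1) ∂(expMeasure 1)) *
        poissonLaw V B := by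
  set c := ∫⁻ t in A, ENNReal.ofReal (Real.exp (-t)) ^ (Fintype.card V - 1) ∂(expMeasure 1)
  set E := {ω : Sample V | JumpsFirst ω z} ∩ {ω | ω z 0 ∈ A}
  have h1 : ((poissonLaw V).restrict E).map (dropAt z) = c • poissonLaw V := by
    refine ext_of_generate_finite _ generateFrom_pi.symm isPiSystem_pi ?_ ?_
    · rintro _ ⟨s, hs, rfl⟩
      have hs' : ∀ x, MeasurableSet (s x) := fun x => hs x trivial
      have hm := MeasurableSet.univ_pi hs'
      rw [Measure.map_apply (measurable_dropAt z) hm,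
        Measure.restrict_apply (measurable_dropAt z hm), Set.inter_comm,
        poissonLaw_jumpsFirst_box z hA hs', Measure.smul_apply, smul_eq_mul]
      congr 1
      exact (Measure.pi_pi _ _).symm
    · have := poissonLaw_jumpsFirst_box z hA (s := fun _ => Set.univ) fun _ => MeasurableSet.univ
      simp only [Set.pi_univ, measure_univ, Finset.prod_const_one, mul_one] at this
      rw [Measure.map_apply (measurable_dropAt z) MeasurableSet.univ,
        Measure.restrict_apply (measurable_dropAt z MeasurableSet.univ), Set.inter_comm, this]
      simp [c]
  have h2 := congrArg (fun ν => ν B) h1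
  simp only [Measure.smul_apply, smul_eq_mul] at h2
  rw [← h2, Measure.map_apply (measurable_dropAt z) hB,
    Measure.restrict_apply (measurable_dropAt z hB), Set.inter_comm]

variable [Nonempty V]

theorem poissonLaw_jumpsFirst_inter (z : V) {B : Set (Sample V)} (hB : MeasurableSet B) :
    poissonLaw V ({ω | JumpsFirst ω z} ∩ dropAt z ⁻¹' B) =
      (Fintype.card V : ℝ≥0∞)⁻¹ * poissonLaw V B := by
  have h := poissonLaw_jumpsFirst z MeasurableSet.univ hB
  have hn : Fintype.card V - 1 + 1 = Fintype.card V := Nat.sub_add_cancel Fintype.card_pos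
  rw [Measure.restrict_univ, lintegral_exp_pow, hn] at h
  simpa using h

theorem ae_exists_jumpsFirst : ∀ᵐ ω ∂(poissonLaw V), ∃ z, JumpsFirst ω z := by
  have hn : (Fintype.card V : ℝ≥0∞) ≠ 0 := Nat.cast_ne_zero.2 Fintype.card_ne_zero
  have hm : MeasurableSet (⋃ z, {ω : Sample V | JumpsFirst ω z}) :=
    MeasurableSet.iUnion measurableSet_jumpsFirst
  have h1 : poissonLaw V (⋃ z, {ω : Sample V | JumpsFirst ω z}) = 1 := by
    rw [measure_iUnion ?_ measurableSet_jumpsFirst, tsum_fintype]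
    · have : ∀ z : V, poissonLaw V {ω | JumpsFirst ω z} = (Fintype.card V : ℝ≥0∞)⁻¹ := by
        intro z
        have := poissonLaw_jumpsFirst_inter z MeasurableSet.univ
        simpa using this
      simp only [this, Finset.sum_const, Finset.card_univ, nsmul_eq_mul]
      exact ENNReal.mul_inv_cancel hn (by simp)
    · exact fun z z' hne => Set.disjoint_left.2 fun ω h h' => hne (JumpsFirst.eq h h')
  have h2 := (prob_compl_eq_zero_iff hm).2 h1
  refine (measure_eq_zero_iff_ae_notMem.1 h2).mono fun ω hω => ?_
  simpa using hω

variable [MeasurableSpace V] [MeasurableSingletonClass V]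

/-- The second set accounts for the default value of `firstMark` when no process is strictly first;
it is needed for measurability and is null. -/
theorem firstMark_preimage (z : V) : (firstMark : Sample V → V) ⁻¹' {z} =
    {ω | JumpsFirst ω z} ∪
      ((⋃ z, {ω : Sample V | JumpsFirst ω z})ᶜ ∩ {_ω | Classical.arbitrary V = z}) := by
  ext ω
  by_cases h : ∃ z', JumpsFirst ω z'
  · obtain ⟨z', h'⟩ := h
    have h1 : ω ∈ ⋃ z, {ω : Sample V | JumpsFirst ω z} := Set.mem_iUnion.2 ⟨z', h'⟩
    simp only [Set.mem_preimage, Set.mem_singleton_iff, h'.firstMark_eq, Set.mem_union,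
      Set.mem_inter_iff, Set.mem_compl_iff, h1, not_true_eq_false, false_and, or_false]
    exact ⟨fun e => e ▸ h', fun e => h'.eq e⟩
  · have h1 : ω ∉ ⋃ z, {ω : Sample V | JumpsFirst ω z} := fun h1 => h (Set.mem_iUnion.1 h1)
    have h2 : firstMark ω = Classical.arbitrary V := dif_neg h
    simp only [Set.mem_preimage, Set.mem_singleton_iff, h2, Set.mem_union, Set.mem_inter_iff,
      Set.mem_compl_iff, h1, not_false_eq_true, true_and]
    exact ⟨Or.inr, fun e => e.elim (fun e => (h ⟨z, e⟩).elim) id⟩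

theorem measurable_firstMark : Measurable (firstMark : Sample V → V) := by
  refine measurable_to_countable' fun z => ?_
  rw [firstMark_preimage]
  exact (measurableSet_jumpsFirst z).union
    ((MeasurableSet.iUnion measurableSet_jumpsFirst).compl.inter (MeasurableSet.const _))

theorem measurable_dropFirst : Measurable (dropFirst : Sample V → Sample V) := by
  have h1 : Measurable fun p : V × Sample V => dropAt p.1 p.2 :=
    measurable_from_prod_countable_right measurable_dropAt
  exact h1.comp (measurable_firstMark.prodMk measurable_id)

theorem measurable_firstTime : Measurable (firstTime : Sample V → ℝ) := by
  have h1 : Measurable fun p : V × Sample V => p.2 p.1 0 :=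
    measurable_from_prod_countable_right fun z => by fun_prop
  exact h1.comp (measurable_firstMark.prodMk measurable_id)

theorem ae_eq_jumpsFirst (z : V) : (firstMark : Sample V → V) ⁻¹' {z} =ᵐ[poissonLaw V]
    {ω | JumpsFirst ω z} := by
  filter_upwards [ae_exists_jumpsFirst (V := V)] with ω hω
  obtain ⟨z', h'⟩ := hω
  refine propext ?_
  change firstMark ω = z ↔ JumpsFirst ω z
  rw [h'.firstMark_eq]
  exact ⟨fun e => e ▸ h', fun e => h'.eq e⟩

theorem isUniformMark : IsUniformMark (poissonLaw V) firstMark dropFirst where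
  measurable_mark := measurable_firstMark
  measurable_shift := measurable_dropFirst
  measure_inter z B hB := by
    have h1 : firstMark ⁻¹' {z} ∩ dropFirst ⁻¹' B = firstMark ⁻¹' {z} ∩ dropAt z ⁻¹' B := by
      ext ω
      simp only [Set.mem_inter_iff, Set.mem_preimage, Set.mem_singleton_iff, dropFirst]
      exact and_congr_right fun h => by rw [h]
    rw [h1, ← poissonLaw_jumpsFirst_inter z hB]
    exact measure_congr ((ae_eq_jumpsFirst z).inter (ae_eq_refl _))

theorem measure_firstTime_inter {A : Set ℝ} (hA : MeasurableSet A) {B : Set (Sample V)}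
    (hB : MeasurableSet B) :
    poissonLaw V (firstTime ⁻¹' A ∩ dropFirst ⁻¹' B) =
      Fintype.card V * (∫⁻ t in A, ENNReal.ofReal (Real.exp (-t)) ^ (Fintype.card V - 1)
        ∂(expMeasure 1)) * poissonLaw V B := by
  rw [isUniformMark.measure_eq_sum]
  have h1 : ∀ z : V, poissonLaw V (firstMark ⁻¹' {z} ∩ (firstTime ⁻¹' A ∩ dropFirst ⁻¹' B)) =
      (∫⁻ t in A, ENNReal.ofReal (Real.exp (-t)) ^ (Fintype.card V - 1) ∂(expMeasure 1)) *
        poissonLaw V B := by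
    intro z
    have h1 : firstMark ⁻¹' {z} ∩ (firstTime ⁻¹' A ∩ dropFirst ⁻¹' B) =
        firstMark ⁻¹' {z} ∩ ({ω | ω z 0 ∈ A} ∩ dropAt z ⁻¹' B) := by
      ext ω
      simp only [Set.mem_inter_iff, Set.mem_preimage, Set.mem_singleton_iff, dropFirst, firstTime]
      refine and_congr_right fun h => ?_
      rw [h]
      rfl
    rw [h1, ← poissonLaw_jumpsFirst z hA hB, Set.inter_assoc]
    exact measure_congr ((ae_eq_jumpsFirst z).inter (ae_eq_refl _))
  rw [Finset.sum_congr rfl fun z _ => h1 z, Finset.sum_const, Finset.card_univ, nsmul_eq_mul,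
    mul_assoc]

/-- Makes the successive waiting times independent, so that the strong law applies to the jump
times. -/
theorem indepFun_firstTime : IndepFun firstTime dropFirst (poissonLaw V) := by
  rw [indepFun_iff_measure_inter_preimage_eq_mul]
  intro A B hA hB
  have h1 := measure_firstTime_inter (V := V) hA MeasurableSet.univ
  simp only [Set.preimage_univ, Set.inter_univ, measure_univ, mul_one] at h1
  rw [measure_firstTime_inter hA hB, h1,
    isUniformMark.measurePreserving.measure_preimage hB.nullMeasurableSet]

theorem map_firstTime : (poissonLaw V).map firstTime = (Fintype.card V : ℝ≥0∞) •
    (expMeasure 1).withDensity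
      fun t => ENNReal.ofReal (Real.exp (-t)) ^ (Fintype.card V - 1) := by
  refine Measure.ext fun A hA => ?_
  have h1 := measure_firstTime_inter (V := V) hA MeasurableSet.univ
  simp only [Set.preimage_univ, Set.inter_univ, measure_univ, mul_one] at h1
  rw [Measure.map_apply measurable_firstTime hA, h1, Measure.smul_apply, smul_eq_mul,
    withDensity_apply _ hA]

theorem ae_firstTime_pos : ∀ᵐ ω ∂(poissonLaw V), 0 < firstTime ω := by
  have h1 : ∀ᵐ t ∂((poissonLaw V).map firstTime), 0 < t := by
    rw [map_firstTime]
    exact Measure.ae_smul_measure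
      ((withDensity_absolutelyContinuous _ _).ae_le ae_expMeasure_pos) _
  exact ae_of_ae_map measurable_firstTime.aemeasurable h1

theorem lintegral_firstTime : ∫⁻ ω, ENNReal.ofReal (firstTime ω) ∂(poissonLaw V) =
    (Fintype.card V : ℝ≥0∞)⁻¹ := by
  have hn : Fintype.card V - 1 + 1 = Fintype.card V := Nat.sub_add_cancel Fintype.card_pos
  have h1 := lintegral_map (μ := poissonLaw V) ENNReal.measurable_ofReal measurable_firstTime
  rw [← h1, map_firstTime, lintegral_smul_measure,
    lintegral_withDensity_eq_lintegral_mul _ (by fun_prop) ENNReal.measurable_ofReal]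
  have h2 := lintegral_mul_exp_pow (Fintype.card V - 1)
  rw [hn] at h2
  simp only [Pi.mul_apply, mul_comm _ (ENNReal.ofReal _)]
  rw [h2, smul_eq_mul, pow_two, ← mul_assoc, ENNReal.mul_inv_cancel (by simp) (by simp), one_mul]

theorem integrable_firstTime : Integrable firstTime (poissonLaw V) := by
  refine ⟨measurable_firstTime.aestronglyMeasurable, ?_⟩
  rw [hasFiniteIntegral_iff_ofReal (ae_firstTime_pos.mono fun _ h => h.le), lintegral_firstTime]
  simpa using Fintype.card_pos

theorem integral_firstTime : ∫ ω, firstTime ω ∂(poissonLaw V) = (Fintype.card V : ℝ)⁻¹ := by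
  rw [integral_eq_lintegral_of_nonneg_ae (ae_firstTime_pos.mono fun _ h => h.le)
    measurable_firstTime.aestronglyMeasurable, lintegral_firstTime]
  simp

end FirstJump

/-! ### From the jump chain to continuous time -/

section Embedding

set_option linter.unusedSectionVars false

variable {V : Type*} [Fintype V] [Nonempty V]

/-- All waiting times are positive and no two processes jump at the same time. -/
def IsRegularSample (ω : Sample V) : Prop :=
  ∀ k, (∀ x i, 0 < dropFirst^[k] ω x i) ∧ ∃ z, JumpsFirst (dropFirst^[k] ω) z

theorem ae_isRegularSample [MeasurableSpace V] [MeasurableSingletonClass V] :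
    ∀ᵐ ω ∂(poissonLaw V), IsRegularSample ω := by
  have h1 : ∀ᵐ ω ∂(poissonLaw V), ∀ x i, 0 < ω x i := by
    refine ae_all_iff.2 fun x => ae_all_iff.2 fun i => ?_
    have e1 := measurePreserving_eval (fun _ : V => clockLaw) x
    have e2 := measurePreserving_eval_infinitePi (fun _ : ℕ => expMeasure 1) i
    exact (e2.comp e1).quasiMeasurePreserving.ae ae_expMeasure_pos
  have h2 := h1.and ae_exists_jumpsFirst
  exact ae_all_iff.2 fun k =>
    (isUniformMark.measurePreserving.iterate k).quasiMeasurePreserving.ae h2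

theorem arrival_pos {ω : Sample V} (h : ∀ x i, 0 < ω x i) (x : V) (i : ℕ) : 0 < arrival ω x i :=
  Finset.sum_pos (fun _ _ => h x _) ⟨0, by simp⟩

/-- Dropping the first jump shifts all arrival times by `firstTime ω` and deletes one arrival, which
is the case s = 0. -/
theorem exists_arrival_eq_add (ω : Sample V) (x : V) (s : ℝ) :
    (∃ i, arrival ω x i = firstTime ω + s) ↔
      (x = firstMark ω ∧ s = 0) ∨ ∃ i, arrival (dropFirst ω) x i = s := by
  by_cases hx : x = firstMark ω
  · have h0 : arrival ω x 0 = firstTime ω := by simp [arrival, firstTime, hx]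
    have h1 : ∀ i, arrival ω x (i + 1) = firstTime ω + arrival (dropFirst ω) x i := by
      intro i
      rw [← h0, arrival, Finset.sum_range_succ', add_comm]
      simp [arrival, dropFirst, dropAt, ← hx]
    constructor
    · rintro ⟨i, hi⟩
      cases i with
      | zero => exact Or.inl ⟨hx, by rw [h0] at hi; linarith⟩
      | succ i => exact Or.inr ⟨i, by rw [h1] at hi; linarith⟩
    · rintro (⟨-, rfl⟩ | ⟨i, rfl⟩)
      · exact ⟨0, by rw [h0, add_zero]⟩
      · exact ⟨i + 1, h1 i⟩
  · have h1 : ∀ i, arrival ω x i = firstTime ω + arrival (dropFirst ω) x i := by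
      intro i
      rw [arrival, arrival, Finset.sum_range_succ', Finset.sum_range_succ']
      simp [dropFirst, dropAt, hx, subHead, firstTime]
      ring
    simp only [hx, false_and, false_or, h1, add_right_inj]

/-- The sum of the first `k` waiting times between consecutive jumps. -/
noncomputable def totalTime (ω : Sample V) (k : ℕ) : ℝ :=
  ∑ j ∈ Finset.range k, firstTime (dropFirst^[j] ω)

theorem IsRegularSample.firstTime_pos {ω : Sample V} (h : IsRegularSample ω) (k : ℕ) :
    0 < firstTime (dropFirst^[k] ω) := (h k).1 _ _

theorem IsRegularSample.strictMono_totalTime {ω : Sample V} (h : IsRegularSample ω) :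
    StrictMono (totalTime ω) :=
  strictMono_nat_of_lt_succ fun k => by
    rw [totalTime, totalTime, Finset.sum_range_succ]
    exact lt_add_of_pos_right _ (h.firstTime_pos k)

theorem IsRegularSample.exists_arrival_iff {ω : Sample V} (h : IsRegularSample ω) (k : ℕ) (x : V)
    {s : ℝ} (hs : 0 < s) :
    (∃ i, arrival ω x i = totalTime ω k + s) ↔ ∃ i, arrival (dropFirst^[k] ω) x i = s := by
  induction k generalizing s with
  | zero => simp [totalTime]
  | succ k ih =>
    have h1 := ih (s := firstTime (dropFirst^[k] ω) + s) (add_pos (h.firstTime_pos k) hs)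
    rw [totalTime, Finset.sum_range_succ, add_assoc, ← totalTime, h1, exists_arrival_eq_add,
      ← Function.iterate_succ_apply' dropFirst]
    simp [hs.ne']

theorem IsRegularSample.jumpTime_eq {ω : Sample V} (h : IsRegularSample ω) (k : ℕ) :
    jumpTime ω k = totalTime ω k := by
  induction k with
  | zero => simp [jumpTime, totalTime]
  | succ k ih =>
    rw [jumpTime, ih]
    refine IsLeast.csInf_eq ⟨⟨h.strictMono_totalTime k.lt_succ_self, ?_⟩, ?_⟩
    · refine ⟨firstMark (dropFirst^[k] ω), ?_⟩
      rw [totalTime, Finset.sum_range_succ, ← totalTime,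
        h.exists_arrival_iff k _ (h.firstTime_pos k)]
      exact ⟨0, by simp [arrival, firstTime]⟩
    · rintro t ⟨ht, x, hx⟩
      have ht' : t = totalTime ω k + (t - totalTime ω k) := by ring
      rw [ht', h.exists_arrival_iff k _ (sub_pos.2 ht)] at hx
      obtain ⟨i, hi⟩ := hx
      have h1 : arrival (dropFirst^[k] ω) x i = firstTime (dropFirst^[k] ω) +
          (arrival (dropFirst^[k] ω) x i - firstTime (dropFirst^[k] ω)) := by ring
      have h2 : firstTime (dropFirst^[k] ω) ≤ arrival (dropFirst^[k] ω) x i := by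
        rcases (exists_arrival_eq_add _ _ _).1 ⟨i, h1⟩ with ⟨-, h3⟩ | ⟨j, hj⟩
        · linarith
        · have h4 := arrival_pos (h (k + 1)).1 x j
          rw [Function.iterate_succ_apply'] at h4
          linarith
      rw [totalTime, Finset.sum_range_succ, ← totalTime]
      linarith

theorem IsRegularSample.exists_arrival_eq_jumpTime {ω : Sample V} (h : IsRegularSample ω) (k : ℕ)
    (x : V) : (∃ i, arrival ω x i = jumpTime ω (k + 1)) ↔ x = marks firstMark dropFirst ω k := by
  rw [h.jumpTime_eq, totalTime, Finset.sum_range_succ, ← totalTime,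
    h.exists_arrival_iff k _ (h.firstTime_pos k)]
  have h1 := exists_arrival_eq_add (dropFirst^[k] ω) x 0
  rw [add_zero] at h1
  rw [h1, ← Function.iterate_succ_apply' dropFirst]
  constructor
  · rintro (⟨h2, -⟩ | ⟨i, hi⟩)
    · exact h2
    · exact absurd hi (arrival_pos (h (k + 1)).1 x i).ne'
  · exact fun h2 => Or.inl ⟨h2, rfl⟩

theorem IsRegularSample.heightAfterJump_eq {ω : Sample V} (h : IsRegularSample ω)
    (G : SimpleGraph V) (k : ℕ) :
    heightAfterJump G ω k = run G 0 (marks firstMark dropFirst ω) k := by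
  induction k with
  | zero => rfl
  | succ k ih =>
    funext x
    rw [heightAfterJump, run, ih, jumpAt]
    dsimp only
    by_cases hx : x = marks firstMark dropFirst ω k
    · rw [if_pos ((h.exists_arrival_eq_jumpTime k x).2 hx), if_pos hx]
    · rw [if_neg (mt (h.exists_arrival_eq_jumpTime k x).1 hx), if_neg hx]

/-- The number of jumps up to time `t` grows like `n t`, if the `k`-th jump occurs at a time
asymptotic to `k / n`. -/
theorem IsRegularSample.tendsto_jumpCount {ω : Sample V} (h : IsRegularSample ω) {τ : ℝ}
    (hτ : 0 < τ) (hlim : Tendsto (fun k : ℕ => totalTime ω k / k) atTop (𝓝 τ)) :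
    Tendsto (jumpCount ω) atTop atTop ∧
      Tendsto (fun t : ℝ => (jumpCount ω t : ℝ) / t) atTop (𝓝 τ⁻¹) := by
  have hinf : Tendsto (totalTime ω) atTop atTop := by
    have h1 := hlim.pos_mul_atTop hτ (tendsto_natCast_atTop_atTop (R := ℝ))
    refine h1.congr' ?_
    filter_upwards [eventually_gt_atTop 0] with k hk
    have : (k : ℝ) ≠ 0 := by exact_mod_cast hk.ne'
    field_simp
  have hset : ∀ t : ℝ, {k : ℕ | jumpTime ω k ≤ t} = {k : ℕ | totalTime ω k ≤ t} := by
    intro t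
    simp only [h.jumpTime_eq]
  have hbdd : ∀ t : ℝ, BddAbove {k : ℕ | totalTime ω k ≤ t} := by
    intro t
    obtain ⟨K, hK⟩ := (hinf.eventually_gt_atTop t).exists
    refine ⟨K, fun k hk => ?_⟩
    exact (h.strictMono_totalTime.lt_iff_lt.1 (lt_of_le_of_lt hk hK)).le
  have hge : ∀ (k : ℕ) (t : ℝ), totalTime ω k ≤ t → k ≤ jumpCount ω t := by
    intro k t hk
    rw [jumpCount, hset]
    exact le_csSup (hbdd t) hk
  have hmem : ∀ t : ℝ, 0 ≤ t → totalTime ω (jumpCount ω t) ≤ t := by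
    intro t ht
    rw [jumpCount, hset]
    exact Nat.sSup_mem ⟨0, by simpa [totalTime] using ht⟩ (hbdd t)
  have hlt : ∀ t : ℝ, t < totalTime ω (jumpCount ω t + 1) := by
    intro t
    by_contra hcon
    have := hge _ _ (not_lt.1 hcon)
    omega
  have hN : Tendsto (jumpCount ω) atTop atTop := by
    refine tendsto_atTop.2 fun k => ?_
    filter_upwards [eventually_ge_atTop (totalTime ω k)] with t ht using hge k t ht
  refine ⟨hN, ?_⟩
  have hupper : Tendsto (fun k : ℕ => totalTime ω (k + 1) / k) atTop (𝓝 τ) := by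
    have h1 := hlim.comp (tendsto_add_atTop_nat 1)
    have h2 : Tendsto (fun k : ℕ => ((k + 1 : ℕ) : ℝ) / k) atTop (𝓝 1) := by
      have h3 : Tendsto (fun k : ℕ => 1 + 1 / (k : ℝ)) atTop (𝓝 (1 + 0)) :=
        tendsto_const_nhds.add tendsto_one_div_atTop_nhds_zero_nat
      rw [add_zero] at h3
      refine h3.congr' ?_
      filter_upwards [eventually_gt_atTop 0] with k hk
      have : (k : ℝ) ≠ 0 := by exact_mod_cast hk.ne'
      push_cast
      field_simp
    have h4 := h1.mul h2
    rw [mul_one] at h4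
    refine h4.congr fun k => ?_
    have : ((k + 1 : ℕ) : ℝ) ≠ 0 := by positivity
    simp only [Function.comp]
    field_simp
  -- With N jumps up to time t, t lies between the times of the N-th and the (N + 1)-st jump.
  have hsq : Tendsto (fun t : ℝ => t / jumpCount ω t) atTop (𝓝 τ) := by
    refine tendsto_of_tendsto_of_tendsto_of_le_of_le' (hlim.comp hN) (hupper.comp hN) ?_ ?_
    · filter_upwards [eventually_ge_atTop 0] with t ht
      exact div_le_div_of_nonneg_right (hmem t ht) (Nat.cast_nonneg _)
    · filter_upwards with t
      exact div_le_div_of_nonneg_right (hlt t).le (Nat.cast_nonneg _)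
  refine (hsq.inv₀ hτ.ne').congr fun t => ?_
  rw [inv_div]

/-- On a finite connected graph both limits defining the growth parameter exist, and `n` times the
drift of any potential dominated by the maximal height is a lower bound for it. -/
theorem exists_isGrowthParameter {G : SimpleGraph V} (hG : G.Connected) :
    ∃ g : ℝ, IsGrowthParameter G g ∧
      ∀ (F : (V → ℕ) → ℝ) (δ C : ℝ), (∀ h, F h ≤ top h + C) → (∀ h, F h + δ ≤ avg G F h) →
        Fintype.card V * δ ≤ g := by
  let _ : MeasurableSpace V := ⊤
  obtain ⟨g, hg, hF⟩ := (isUniformMark (V := V)).exists_growth hG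
  have hn : (0 : ℝ) < Fintype.card V := Nat.cast_pos.2 Fintype.card_pos
  refine ⟨g * Fintype.card V, ?_, fun F δ C h1 h2 => ?_⟩
  · have hτ := strong_law_of_indepFun (isUniformMark (V := V)).measurePreserving
      measurable_firstTime integrable_firstTime indepFun_firstTime
    rw [integral_firstTime] at hτ
    filter_upwards [hg, hτ, ae_isRegularSample (V := V)] with ω h1 h2 h3
    obtain ⟨hN, hNt⟩ := h3.tendsto_jumpCount (inv_pos.2 hn) h2
    rw [inv_inv] at hNt
    have key : ∀ f : ℕ → ℝ, Tendsto (fun k : ℕ => f k / k) atTop (𝓝 g) →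
        Tendsto (fun t : ℝ => f (jumpCount ω t) / t) atTop (𝓝 (g * Fintype.card V)) := by
      intro f hf
      refine ((hf.comp hN).mul hNt).congr' ?_
      filter_upwards [hN.eventually_gt_atTop 0] with t ht
      have : (jumpCount ω t : ℝ) ≠ 0 := by exact_mod_cast ht.ne'
      simp only [Function.comp]
      field_simp
    simp only [height, h3.heightAfterJump_eq, iSup_eq_top]
    exact ⟨key _ h1.1, key _ h1.2⟩
  · rw [mul_comm]
    exact mul_le_mul_of_nonneg_right (hF F δ C h1 h2) hn.le

theorem isGrowthParameter_growthParameter {G : SimpleGraph V} (hG : G.Connected) :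
    IsGrowthParameter G (growthParameter G) := by
  obtain ⟨g, hg, -⟩ := exists_isGrowthParameter hG
  have h : ∃ g, IsGrowthParameter G g := ⟨g, hg⟩
  rw [growthParameter, dif_pos h]
  exact h.choose_spec

theorem card_mul_le_growthParameter {G : SimpleGraph V} (hG : G.Connected) {F : (V → ℕ) → ℝ}
    {δ C : ℝ} (h1 : ∀ h, F h ≤ top h + C) (h2 : ∀ h, F h + δ ≤ avg G F h) :
    Fintype.card V * δ ≤ growthParameter G := by
  obtain ⟨g, hg, hF⟩ := exists_isGrowthParameter hG
  rw [(isGrowthParameter_growthParameter hG).unique hg]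
  exact hF F δ C h1 h2

end Embedding

/-! ### The potential and its drift on regular graphs of girth at least 5 -/

section Drift

open Classical

set_option linter.unusedSectionVars false

variable {V : Type*} [Fintype V] {G : SimpleGraph V}

/-- Two distinct common neighbours would close a 4-cycle. -/
theorem eq_of_adj_of_five_le_egirth (hG : 5 ≤ G.egirth) {x y u v : V} (hxy : x ≠ y)
    (hxu : G.Adj x u) (hyu : G.Adj y u) (hxv : G.Adj x v) (hyv : G.Adj y v) : u = v := by
  by_contra huv
  let w : G.Walk x x := .cons hxu (.cons hyu.symm (.cons hyv (.cons hxv.symm .nil)))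
  have hw : w.IsCycle := by
    simp [w, SimpleGraph.Walk.isCycle_def, SimpleGraph.Walk.isTrail_def, hxy, hxy.symm, huv,
      hxu.ne, hxv.ne, hyv.ne, hxu.ne', hyu.ne', hxv.ne']
  have h1 := SimpleGraph.le_egirth.1 hG x w hw
  have h2 : w.length = 4 := rfl
  rw [h2] at h1
  exact absurd h1 (by decide)

theorem card_closedNbhd_inter_le (hG : 5 ≤ G.egirth) {x y : V} (hxy : x ≠ y) :
    (closedNbhd G x ∩ closedNbhd G y).card ≤ 3 := by
  have h1 : closedNbhd G x ∩ closedNbhd G y ⊆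
      {x, y} ∪ (Finset.univ.filter fun u => G.Adj x u ∧ G.Adj y u) := by
    intro u hu
    simp only [Finset.mem_inter, mem_closedNbhd] at hu
    simp only [Finset.mem_union, Finset.mem_insert, Finset.mem_singleton, Finset.mem_filter,
      Finset.mem_univ, true_and]
    tauto
  have h2 : (Finset.univ.filter fun u => G.Adj x u ∧ G.Adj y u).card ≤ 1 := by
    refine Finset.card_le_one.2 fun u hu v hv => ?_
    have hu := (Finset.mem_filter.1 hu).2
    have hv := (Finset.mem_filter.1 hv).2
    exact eq_of_adj_of_five_le_egirth hG hxy hu.1 hu.2 hv.1 hv.2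
  have h3 := (Finset.card_le_card h1).trans (Finset.card_union_le _ _)
  have h4 := Finset.card_le_two (a := x) (b := y)
  omega

theorem card_closedNbhd {d : ℕ} (hd : G.IsRegularOfDegree d) (x : V) :
    (closedNbhd G x).card = d + 1 := by
  have h1 : closedNbhd G x = insert x (G.neighborFinset x) := by
    ext y
    simp [mem_closedNbhd]
  rw [h1, Finset.card_insert_of_notMem (by simp), SimpleGraph.card_neighborFinset_eq_degree, hd x]

theorem card_biUnion_closedNbhd_le {d : ℕ} (hd : G.IsRegularOfDegree d) (S : Finset V) :
    (S.biUnion (closedNbhd G)).card ≤ S.card * (d + 1) :=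
  Finset.card_biUnion_le_card_mul _ _ _ fun x _ => (card_closedNbhd hd x).le

/-- Adding a vertex to S loses at most 3 per earlier vertex through overlaps, so the total loss is
quadratic in |S| and independent of d. -/
theorem le_card_biUnion_closedNbhd (hG : 5 ≤ G.egirth) {d : ℕ} (hd : G.IsRegularOfDegree d)
    (S : Finset V) : S.card * (d + 1) ≤ (S.biUnion (closedNbhd G)).card + 3 * S.card ^ 2 := by
  induction S using Finset.induction_on with
  | empty => simp
  | insert x S hx ih =>
    rw [Finset.biUnion_insert, Finset.card_insert_of_notMem hx]
    have h1 := Finset.card_union_add_card_inter (closedNbhd G x) (S.biUnion (closedNbhd G))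
    have h2 : (closedNbhd G x ∩ S.biUnion (closedNbhd G)).card ≤ S.card * 3 := by
      rw [Finset.inter_biUnion]
      exact Finset.card_biUnion_le_card_mul _ _ _ fun y hy =>
        card_closedNbhd_inter_le hG fun e => hx (e ▸ hy)
    rw [card_closedNbhd hd] at h1
    nlinarith

/-- The relative value of a configuration with `b` vertices of maximal height and `a` vertices
just below it. -/
def weight (a b : ℕ) : ℤ :=
  if 3 ≤ b then 144
  else if b = 2 then (if 2 ≤ a then 129 else if a = 1 then 124 else 114)
  else (if 2 ≤ a then 86 else if a = 1 then 62 else 0)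

/-- The vertices of maximal height. -/
noncomputable def peaks (h : V → ℕ) : Finset V := Finset.univ.filter fun x => h x = top h

/-- The vertices whose height is one below the maximum. -/
noncomputable def shoulders (h : V → ℕ) : Finset V := Finset.univ.filter fun x => h x + 1 = top h

theorem mem_peaks {h : V → ℕ} {x : V} : x ∈ peaks h ↔ h x = top h := by simp [peaks]

theorem mem_shoulders {h : V → ℕ} {x : V} : x ∈ shoulders h ↔ h x + 1 = top h := by
  simp [shoulders]

/-- The potential of a configuration. -/
noncomputable def potential (h : V → ℕ) : ℤ :=
  118 * top h + weight (shoulders h).card (peaks h).card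

theorem weight_nonneg (a b : ℕ) : 0 ≤ weight a b := by
  unfold weight; split_ifs <;> omega

theorem weight_le (a b : ℕ) : weight a b ≤ 144 := by
  unfold weight; split_ifs <;> omega

theorem weight_mono_left {a a' : ℕ} (h : a ≤ a') (b : ℕ) : weight a b ≤ weight a' b := by
  unfold weight; split_ifs <;> omega

/-- For a jump at a peak itself, which leaves only b - 1 shoulders: the potential still does not
decrease. -/
theorem weight_le_of_pred (a b : ℕ) : weight a b ≤ 118 + weight (b - 1) 1 := by
  unfold weight; split_ifs <;> omega

theorem weight_le_succ_of_pred {b : ℕ} (hb : 1 ≤ b) (a : ℕ) :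
    weight a b ≤ weight (a - 1) (b + 1) := by
  unfold weight; split_ifs <;> omega

theorem mem_biUnion_closedNbhd {S : Finset V} {z : V} :
    z ∈ S.biUnion (closedNbhd G) ↔ ∃ y ∈ closedNbhd G z, y ∈ S := by
  simp only [Finset.mem_biUnion, mem_closedNbhd]
  constructor
  · rintro ⟨y, hy, rfl | h⟩
    exacts [⟨z, Or.inl rfl, hy⟩, ⟨y, Or.inr h.symm, hy⟩]
  · rintro ⟨y, rfl | h, hy⟩
    exacts [⟨y, hy, Or.inl rfl⟩, ⟨y, hy, Or.inr h.symm⟩]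

/-- The jump sets a record: z becomes the only peak, and the other old peaks become the shoulders.
-/
theorem potential_jumpAt_of_mem_peaks {h : V → ℕ} {z : V}
    (hz : z ∈ (peaks h).biUnion (closedNbhd G)) :
    potential (jumpAt G h z) = 118 * (top h + 1) + weight ((peaks h).erase z).card 1 := by
  obtain ⟨y, hy, hy'⟩ := mem_biUnion_closedNbhd.1 hz
  have e0 : jumpAt G h z z = top h + 1 := by
    have h1 := lt_jumpAt h hy
    rw [mem_peaks.1 hy'] at h1
    exact le_antisymm (jumpAt_le_top h z z) h1
  have e1 : top (jumpAt G h z) = top h + 1 :=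
    le_antisymm (top_le (jumpAt_le_top h z)) (e0 ▸ le_top _ z)
  have e2 : peaks (jumpAt G h z) = {z} := by
    ext x
    rw [mem_peaks, e1, Finset.mem_singleton]
    by_cases hx : x = z
    · simp [hx, e0]
    · rw [jumpAt_of_ne _ hx]
      have := le_top h x
      simp only [hx, iff_false]
      omega
  have e3 : shoulders (jumpAt G h z) = (peaks h).erase z := by
    ext x
    rw [mem_shoulders, e1, Finset.mem_erase, mem_peaks]
    by_cases hx : x = z
    · subst hx
      simp [e0]
    · rw [jumpAt_of_ne _ hx]
      simp [hx]
  rw [potential, e1, e2, e3, Finset.card_singleton]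
  push_cast
  ring

/-- The vertex z lands exactly at the old maximum: it joins the peaks, and stops being a shoulder if
it was one. -/
theorem potential_jumpAt_of_mem_shoulders {h : V → ℕ} {z : V}
    (hz : z ∉ (peaks h).biUnion (closedNbhd G)) (hz' : z ∈ (shoulders h).biUnion (closedNbhd G)) :
    potential (jumpAt G h z) =
      118 * top h + weight ((shoulders h).erase z).card ((peaks h).card + 1) := by
  obtain ⟨y, hy, hy'⟩ := mem_biUnion_closedNbhd.1 hz'
  have hlt : ∀ w ∈ closedNbhd G z, h w < top h := fun w hw =>
    lt_of_le_of_ne (le_top h w) fun e => hz (mem_biUnion_closedNbhd.2 ⟨w, hw, mem_peaks.2 e⟩)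
  have hyt := mem_shoulders.1 hy'
  have e0 : jumpAt G h z z = top h := by
    refine le_antisymm ?_ ?_
    · rw [jumpAt_self]
      have : (closedNbhd G z).sup h ≤ h y := Finset.sup_le fun w hw => by
        have := hlt w hw
        omega
      omega
    · have := lt_jumpAt h hy
      omega
  have e1 : top (jumpAt G h z) = top h := by
    refine le_antisymm (top_le fun x => ?_) (e0 ▸ le_top _ z)
    by_cases hx : x = z
    · rw [hx, e0]
    · rw [jumpAt_of_ne _ hx]
      exact le_top h x
  have hzp : z ∉ peaks h := fun e => hz (mem_biUnion_closedNbhd.2 ⟨z, self_mem_closedNbhd z, e⟩)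
  have e2 : peaks (jumpAt G h z) = insert z (peaks h) := by
    ext x
    rw [mem_peaks, e1, Finset.mem_insert, mem_peaks]
    by_cases hx : x = z
    · simp [hx, e0]
    · rw [jumpAt_of_ne _ hx]
      simp [hx]
  have e3 : shoulders (jumpAt G h z) = (shoulders h).erase z := by
    ext x
    rw [mem_shoulders, e1, Finset.mem_erase, mem_shoulders]
    by_cases hx : x = z
    · subst hx
      simp [e0]
    · rw [jumpAt_of_ne _ hx]
      simp [hx]
  rw [potential, e1, e2, e3, Finset.card_insert_of_notMem hzp]

/-- The vertex z stays below the maximum, so the peaks are unchanged and no shoulder is lost. -/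
theorem potential_le_jumpAt_of_notMem {h : V → ℕ} {z : V}
    (hz : z ∉ (peaks h).biUnion (closedNbhd G)) (hz' : z ∉ (shoulders h).biUnion (closedNbhd G)) :
    potential h ≤ potential (jumpAt G h z) := by
  have hlt : ∀ w ∈ closedNbhd G z, h w + 2 ≤ top h := fun w hw => by
    have h1 := le_top h w
    have h2 : h w ≠ top h := fun e => hz (mem_biUnion_closedNbhd.2 ⟨w, hw, mem_peaks.2 e⟩)
    have h3 : h w + 1 ≠ top h := fun e => hz' (mem_biUnion_closedNbhd.2 ⟨w, hw, mem_shoulders.2 e⟩)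
    omega
  have hzz := hlt z (self_mem_closedNbhd z)
  have e0 : jumpAt G h z z + 1 ≤ top h := by
    rw [jumpAt_self]
    have : (closedNbhd G z).sup h ≤ top h - 2 := Finset.sup_le fun w hw => by
      have := hlt w hw
      omega
    omega
  have e1 : top (jumpAt G h z) = top h := by
    refine le_antisymm (top_le fun x => ?_) (top_le fun x => (le_jumpAt h z x).trans (le_top _ x))
    by_cases hx : x = z
    · rw [hx]
      omega
    · rw [jumpAt_of_ne _ hx]
      exact le_top h x
  have e2 : peaks (jumpAt G h z) = peaks h := by
    ext x
    rw [mem_peaks, e1, mem_peaks]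
    by_cases hx : x = z
    · subst hx
      omega
    · rw [jumpAt_of_ne _ hx]
  have e3 : shoulders h ⊆ shoulders (jumpAt G h z) := by
    intro x hx
    rw [mem_shoulders] at hx ⊢
    have : x ≠ z := by
      rintro rfl
      omega
    rw [e1, jumpAt_of_ne _ this, hx]
  rw [potential, potential, e1, e2]
  have := weight_mono_left (Finset.card_le_card e3) (peaks h).card
  omega

theorem peaks_card_pos [Nonempty V] (h : V → ℕ) : 1 ≤ (peaks h).card := by
  obtain ⟨x, hx⟩ := exists_eq_top h
  exact Finset.card_pos.2 ⟨x, mem_peaks.2 hx⟩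

/-- The drift of the potential, in terms of the numbers of neighbours of the highest vertices. -/
theorem drift_potential [Nonempty V] (h : V → ℕ) :
    (118 + weight (peaks h).card 1 - weight (shoulders h).card (peaks h).card) *
        ((peaks h).biUnion (closedNbhd G)).card +
      (weight (shoulders h).card ((peaks h).card + 1) -
          weight (shoulders h).card (peaks h).card) *
        ((shoulders h).biUnion (closedNbhd G) \ (peaks h).biUnion (closedNbhd G)).card - 816 ≤
      ∑ z, (potential (jumpAt G h z) - potential h) := by
  set B := peaks h with hB
  set A := shoulders h with hA
  set a := A.card with ha
  set b := B.card with hb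
  have hb1 : 1 ≤ b := peaks_card_pos h
  set NB := B.biUnion (closedNbhd G) with hNB
  set NA := A.biUnion (closedNbhd G) \ NB with hNA
  set g₁ : ℤ := 118 + weight b 1 - weight a b with hg₁
  set g₂ : ℤ := weight a (b + 1) - weight a b with hg₂
  -- The exceptional vertices: a jump at a peak or shoulder erases it from its set, which can affect
  -- `weight` only for small sets. There are at most 4, each costing at most 204 = 118 + 86, whence
  -- 816.
  set X : Finset V := (if b ≤ 2 then B else ∅) ∪ (if a ≤ 2 then A else ∅) with hX
  have hXcard : X.card ≤ 4 := by
    refine (Finset.card_union_le _ _).trans ?_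
    have h1 : (if b ≤ 2 then B else ∅).card ≤ 2 := by
      split_ifs with h0
      exacts [h0, by simp]
    have h2 : (if a ≤ 2 then A else ∅).card ≤ 2 := by
      split_ifs with h0
      exacts [h0, by simp]
    omega
  have w0 := weight_nonneg a b
  have w1 := weight_le b 1
  have w2 := weight_le a (b + 1)
  have hpot : potential h = 118 * top h + weight a b := rfl
  have key : ∀ z, (if z ∈ NB then g₁ else 0) + (if z ∈ NA then g₂ else 0) -
      (if z ∈ X then 204 else 0) ≤ potential (jumpAt G h z) - potential h := by
    intro z
    by_cases h1 : z ∈ NB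
    · have h2 : z ∉ NA := fun h2 => (Finset.mem_sdiff.1 h2).2 h1
      rw [if_pos h1, if_neg h2, potential_jumpAt_of_mem_peaks h1, hpot, ← hB]
      by_cases h3 : z ∈ B
      · rw [Finset.card_erase_of_mem h3, ← hb]
        have h4 := weight_le_of_pred a b
        by_cases h5 : b ≤ 2
        · have h6 : z ∈ X := Finset.mem_union_left _ (by rwa [if_pos h5])
          have w3 : weight b 1 ≤ 86 := by unfold weight; split_ifs <;> omega
          rw [if_pos h6]
          omega
        · have h6 : weight (b - 1) 1 = weight b 1 := by unfold weight; split_ifs <;> omega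
          split_ifs <;> omega
      · rw [Finset.erase_eq_of_notMem h3, ← hb]
        split_ifs <;> omega
    · rw [if_neg h1]
      by_cases h2 : z ∈ A.biUnion (closedNbhd G)
      · have h2' : z ∈ NA := Finset.mem_sdiff.2 ⟨h2, h1⟩
        rw [if_pos h2', potential_jumpAt_of_mem_shoulders h1 h2, hpot, ← hB, ← hA, ← hb]
        by_cases h3 : z ∈ A
        · rw [Finset.card_erase_of_mem h3, ← ha]
          have h4 := weight_le_succ_of_pred hb1 a
          by_cases h5 : a ≤ 2
          · have h6 : z ∈ X := Finset.mem_union_right _ (by rwa [if_pos h5])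
            rw [if_pos h6]
            omega
          · have h6 : weight (a - 1) (b + 1) = weight a (b + 1) := by
              unfold weight; split_ifs <;> omega
            split_ifs <;> omega
        · rw [Finset.erase_eq_of_notMem h3, ← ha]
          split_ifs <;> omega
      · have h2' : z ∉ NA := fun h3 => h2 (Finset.mem_sdiff.1 h3).1
        rw [if_neg h2']
        have := potential_le_jumpAt_of_notMem h1 h2
        split_ifs <;> omega
  have hsum := Finset.sum_le_sum fun z (_ : z ∈ Finset.univ) => key z
  simp only [Finset.sum_sub_distrib, Finset.sum_add_distrib, Finset.sum_ite_mem,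
    Finset.univ_inter, Finset.sum_const, nsmul_eq_mul] at hsum ⊢
  have hX' : (X.card : ℤ) ≤ 4 := by exact_mod_cast hXcard
  linarith

/-- The values of `weight` balance the classes: with a cut off at 2 and b at 3, the leading
coefficient b(118 + weight b 1 - weight a b) + a(weight a (b + 1) - weight a b) equals 180 in all
seven cases. The constant 16116 generously absorbs overlaps and exceptional vertices. -/
theorem le_drift_potential [Nonempty V] (hG : 5 ≤ G.egirth) {d : ℕ} (hd : G.IsRegularOfDegree d)
    (h : V → ℕ) :
    180 * ((d : ℤ) + 1) - 16116 ≤ ∑ z, (potential (jumpAt G h z) - potential h) := by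
  refine le_trans ?_ (drift_potential (G := G) h)
  set B := peaks h with hB
  set A := shoulders h with hA
  have hb1 : 1 ≤ B.card := peaks_card_pos h
  have hdisj : Disjoint A B := Finset.disjoint_left.2 fun x hx hx' => by
    have h1 := mem_shoulders.1 hx
    have h2 := mem_peaks.1 hx'
    omega
  obtain ⟨B', hB', hB'c⟩ := Finset.exists_subset_card_eq (min_le_left B.card 3)
  obtain ⟨A', hA', hA'c⟩ := Finset.exists_subset_card_eq (min_le_left A.card 2)
  -- 27 = 3 · 3², the overlap loss for at most 3 peaks.
  have n1 : min B.card 3 * (d + 1) ≤ (B.biUnion (closedNbhd G)).card + 27 := by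
    have h1 := le_card_biUnion_closedNbhd hG hd B'
    have h2 := Finset.card_le_card (Finset.biUnion_subset_biUnion_of_subset_left (closedNbhd G) hB')
    have h3 : B'.card ^ 2 ≤ 3 ^ 2 := Nat.pow_le_pow_left (hB'c ▸ min_le_right _ _) 2
    rw [hB'c] at h1 h3
    omega
  -- 48 = 3 · 4², the overlap loss for at most 2 shoulders and 2 peaks. For b ≥ 3 no such bound is
  -- needed, since another peak no longer changes `weight`.
  have n2 : B.card ≤ 2 → min A.card 2 * (d + 1) ≤
      (A.biUnion (closedNbhd G) \ B.biUnion (closedNbhd G)).card + 48 := by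
    intro hb2
    have h1 := le_card_biUnion_closedNbhd hG hd (A' ∪ B)
    have h2 := card_biUnion_closedNbhd_le hd B
    have hc : (A' ∪ B).card = min A.card 2 + B.card := by
      rw [Finset.card_union_of_disjoint (Finset.disjoint_of_subset_left hA' hdisj), hA'c]
    have h3 : (A' ∪ B).card ^ 2 ≤ 4 ^ 2 := Nat.pow_le_pow_left (by omega) 2
    have h4 : ((A' ∪ B).biUnion (closedNbhd G)).card ≤
        (A.biUnion (closedNbhd G) \ B.biUnion (closedNbhd G)).card +
          (B.biUnion (closedNbhd G)).card := by
      rw [← Finset.card_union_of_disjoint Finset.sdiff_disjoint, Finset.sdiff_union_self_eq_union,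
        ← Finset.union_biUnion]
      exact Finset.card_le_card (Finset.biUnion_subset_biUnion_of_subset_left _
        (Finset.union_subset_union_left hA'))
    rw [hc, add_mul] at h1
    rw [hc] at h3
    omega
  generalize hNB : (B.biUnion (closedNbhd G)).card = p at *
  generalize hNA : (A.biUnion (closedNbhd G) \ B.biUnion (closedNbhd G)).card = q at *
  generalize B.card = b at *
  generalize A.card = a at *
  have hb : b = 1 ∨ b = 2 ∨ 3 ≤ b := by omega
  have ha : a = 0 ∨ a = 1 ∨ 2 ≤ a := by omega
  rcases hb with rfl | rfl | hb
  · have n2 := n2 (by omega)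
    rcases ha with rfl | rfl | ha
    · simp [weight] at n1 n2 ⊢
      omega
    · simp [weight] at n1 n2 ⊢
      omega
    · simp [weight, ha] at n1 n2 ⊢
      omega
  · have n2 := n2 (by omega)
    rcases ha with rfl | rfl | ha
    · simp [weight] at n1 n2 ⊢
      omega
    · simp [weight] at n1 n2 ⊢
      omega
    · simp [weight, ha] at n1 n2 ⊢
      omega
  · simp [weight, hb, show 2 ≤ b by omega, show 3 ≤ b + 1 by omega] at n1 ⊢
    omega

/-- A lower bound for the growth parameter of a regular graph without short cycles. -/
theorem le_growthParameter_of_five_le_egirth (hconn : G.Connected) (hG : 5 ≤ G.egirth) {d : ℕ}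
    (hd : G.IsRegularOfDegree d) :
    (180 * ((d : ℝ) + 1) - 16116) / 118 ≤ growthParameter G := by
  have : Nonempty V := hconn.nonempty
  have hn : (0 : ℝ) < Fintype.card V := Nat.cast_pos.2 Fintype.card_pos
  -- Dividing by 118 gives the maximum coefficient 1, and `weight` is at most 144 ≤ 2 · 118.
  have h1 := card_mul_le_growthParameter hconn (F := fun h => (potential h : ℝ) / 118)
    (δ := (180 * ((d : ℝ) + 1) - 16116) / 118 / Fintype.card V) (C := 2) ?_ ?_
  · rwa [mul_div_cancel₀ _ hn.ne'] at h1
  · intro h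
    have h2 : (potential h : ℝ) ≤ 118 * top h + 144 := by
      have := weight_le (shoulders h).card (peaks h).card
      have h3 : potential h ≤ 118 * top h + 144 := by rw [potential]; omega
      exact_mod_cast h3
    linarith
  · intro h
    have h2 := le_drift_potential hG hd h
    have h3 : (180 * ((d : ℝ) + 1) - 16116) ≤
        ∑ z, (potential (jumpAt G h z) : ℝ) - Fintype.card V * potential h := by
      rw [Finset.sum_sub_distrib, Finset.sum_const, Finset.card_univ, nsmul_eq_mul] at h2
      exact_mod_cast h2
    rw [avg, ← Finset.sum_div, le_div_iff₀ hn, add_mul, div_mul_cancel₀ _ hn.ne']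
    linarith

end Drift

/-! ### Numerical comparison and conclusion -/

theorem growthConstant_bounds : (2 * Real.exp 1 - 1) / (Real.exp 1 - 1) ^ 2 < 90 / 59 ∧
    |(2 * Real.exp 1 - 1) / (Real.exp 1 - 1) ^ 2 - 1.503| < 0.0005 := by
  have h1 := Real.exp_one_gt_d9
  have h2 := Real.exp_one_lt_d9
  set e := Real.exp 1
  have hpos : 0 < (e - 1) ^ 2 := by
    have : 0 < e - 1 := by linarith
    positivity
  refine ⟨?_, abs_sub_lt_iff.2 ⟨?_, ?_⟩⟩
  · rw [div_lt_iff₀ hpos]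
    nlinarith
  · rw [sub_lt_iff_lt_add, div_lt_iff₀ hpos]
    nlinarith
  · rw [sub_lt_comm, lt_div_iff₀ hpos]
    nlinarith

end BallisticDeposition

theorem mainTheorem6 (V : ℕ → Type*) [∀ n, Fintype (V n)] (G : ∀ n, SimpleGraph (V n))
    [∀ n, DecidableRel (G n).Adj] (hconn : ∀ n, (G n).Connected)
    (hreg : ∀ n, ∃ d, (G n).IsRegularOfDegree d)
    (hdeg : Tendsto (fun n => (G n).maxDegree) atTop atTop)
    (hgirth : ∀ n, 5 ≤ (G n).egirth) :
    (∀ n, BallisticDeposition.IsGrowthParameter (G n)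
      (BallisticDeposition.growthParameter (G n))) ∧
    (((2 * Real.exp 1 - 1) / (Real.exp 1 - 1) ^ 2 : ℝ) : EReal) ≤
      liminf (fun n => ((BallisticDeposition.growthParameter (G n) / (G n).maxDegree : ℝ) : EReal))
        atTop ∧
    |(2 * Real.exp 1 - 1) / (Real.exp 1 - 1) ^ 2 - 1.503| < 0.0005 := by
  obtain ⟨hc, habs⟩ := BallisticDeposition.growthConstant_bounds
  refine ⟨fun n => ?_, ?_, habs⟩
  · have : Nonempty (V n) := (hconn n).nonempty
    exact BallisticDeposition.isGrowthParameter_growthParameter (hconn n)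
  · set c := (2 * Real.exp 1 - 1) / (Real.exp 1 - 1) ^ 2
    -- 136 rounds up (16116 - 180) / 118, the constant loss in the bound for the growth parameter.
    have hlim : Tendsto (fun n => (90 / 59 : ℝ) - 136 / (G n).maxDegree) atTop (𝓝 (90 / 59)) := by
      have h1 := (tendsto_const_div_atTop_nhds_zero_nat (136 : ℝ)).comp hdeg
      simpa using h1.const_sub (90 / 59 : ℝ)
    refine le_liminf_of_le (by isBoundedDefault) ?_
    filter_upwards [hlim.eventually (lt_mem_nhds hc), hdeg.eventually_gt_atTop 0] with n h1 h2
    refine EReal.coe_le_coe_iff.2 (h1.le.trans ?_)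
    have : Nonempty (V n) := (hconn n).nonempty
    obtain ⟨d, hd⟩ := hreg n
    have hmax : (G n).maxDegree = d := hd.maxDegree_eq
    have hdpos : (0 : ℝ) < d := by exact_mod_cast hmax ▸ h2
    have h3 := BallisticDeposition.le_growthParameter_of_five_le_egirth (hconn n) (hgirth n)
      (d := d) (by convert hd)
    rw [hmax, le_div_iff₀ hdpos, sub_mul, div_mul_cancel₀ _ hdpos.ne']
    linarith
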